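/- Conventions. All groups are abelian, $p$ is a prime, and $\lambda$ is an infinite cardinal. A *reduced separable $p$-group* is a $p$-group without nonzero divisible subgroups in which every finite set of elements is contained in a finite direct summand. Such a group $G$ carries the norm $\|x\|=\inf\{2^{-n}: p^n \text{ divides } x \text{ in } G\}$; infinite sums in $G$ and density refer to this norm. $\mathfrak K^{rs(p)}_\lambda$ is the class of reduced separable $p$-groups of cardinality $\lambda$; an embedding is an injective homomorphism. A member of $\mathfrak K^{rs(p)}_\lambda$ is universal if every reduced separable $p$-group of cardinality at most $\lambda$ embeds into it. $G$ is *tree-like* if there are elements $x^n_i\in G$ ($n<\omega$, $i\in I_n$) such that 1. $x^n_i$ has order $p^{n+1}$, and $B=\bigoplus_{n,i}\mathbb Z x^n_i$ is a basic subgroup of $G$ (the sum is direct, $B$ is pure in $G$, and $G/B$ is divisible); 2. $|I_n|=\dim_{\mathbb Z/p\mathbb Z}\big((p^nG)[p]/(p^{n+1}G)[p]\big)$ for all $n$; 3. every $g\in G$ has the form $\sum_{n,i} a^n_i\,p^{\max(n-k,0)}x^n_i$ for some $k<\omega$ and integers $a^n_i$ such that for each $n$ only finitely many $a^n_i$ are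 nonzero; 4. there are functions $F_n:I_{n+1}\to I_n$ such that $G$ is generated by a set of elements of the form $\sum_{n\ge k}p^{n-k}x^n_{\eta(n)}$ with $k<\omega$, $\eta\in\prod_{n<\omega}I_n$ and $F_n(\eta(n+1))=\eta(n)$ for all $n$. $\mathfrak K^{tr}_{\langle\aleph_0:n<\omega\rangle\frown\langle\lambda\rangle}$ is the class of partial orders $T$ in which, for each $x\in T$, the set $\{y:y<x\}$ is well ordered of order type $\le\omega$ (the level of $x$), with at most $\aleph_0$ elements on each level $n<\omega$ and at most $\lambda$ elements on level $\omega$. A member is universal if every member embeds into it by an injective map preserving $<$, $\not<$ and levels. $\mathrm{MA}_\lambda(\sigma\text{-centered})$ says: for every nonempty $\sigma$-centered forcing notion and every family of at most $\lambda$ dense subsets of it, there is a filter meeting all of them. For $\lambda<2^{\aleph_0}$ it follows from Martin's axiom MA. **Theorem 4.1 (with the reduction of Conclusion 4.4).** Let $\aleph_0\le\lambda<2^{\aleph_0}$ and assume $\mathrm{MA}_\lambda(\sigma\text{-centered})$. Then: (a) every $G\in\mathfrak K^{rs(p)}_\lambda$ embeds into some $G'\in\mathfrak K^{rs(p)}_\lambda$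 which is tree-like and has a countable dense subset; (b) if $\mathfrak K^{tr}_{\langle\aleph_0:n<\omega\rangle\frown\langle\lambda\rangle}$ has a universal member, then $\mathfrak K^{rs(p)}_\lambda$ has a universal member. -/

import Mathlib

universe u

open Cardinal Ordinal

/-! ### Martin's axiom for σ-centered forcing notions -/

/-- A forcing notion is σ-centered if it is a countable union of centered sets, i.e. of sets all
of whose finite subsets have a common upper bound (a larger condition is a stronger one). -/
def IsSigmaCentered (P : Type u) [Preorder P] : Prop :=
  ∃ C : ℕ → Set P, (⋃ n, C n) = Set.univ ∧
    ∀ n, ∀ s : Finset P, (s : Set P) ⊆ C n → BddAbove (s : Set P)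

/-- `MA_κ(σ-centered)`: for every nonempty σ-centered forcing notion and every family of at most
`κ` dense sets there is a generic set meeting all of them. As larger conditions are stronger,
"dense" is `IsCofinal`, and the generic set is a nonempty directed downward closed set. -/
def MASigmaCentered (κ : Cardinal.{u}) : Prop :=
  ∀ (P : Type u) [Preorder P] [Nonempty P], IsSigmaCentered P →
    ∀ 𝒟 : Set (Set P), #𝒟 ≤ κ → (∀ D ∈ 𝒟, IsCofinal D) →
      ∃ I : Order.Ideal P, ∀ D ∈ 𝒟, ((I : Set P) ∩ D).Nonempty

/-! ### Reduced separable `p`-groups -/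

section Groups

variable (G : Type u) [AddCommGroup G]

/-- A subgroup all of whose elements are divisible inside it by all nonzero integers. -/
def IsDivisibleSubgroup {G : Type u} [AddCommGroup G] (D : AddSubgroup G) : Prop :=
  ∀ m : ℕ, m ≠ 0 → ∀ d ∈ D, ∃ e ∈ D, m • e = d

/-- Reduced separable abelian `p`-groups. Separable: every finite set of elements is contained in
a finite direct summand. -/
structure IsReducedSeparable (p : ℕ) : Prop where
  torsion : ∀ x : G, ∃ n : ℕ, p ^ n • x = 0
  reduced : ∀ D : AddSubgroup G, IsDivisibleSubgroup D → D = ⊥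
  separable : ∀ s : Finset G, ∃ C D : AddSubgroup G,
    IsCompl C D ∧ Finite C ∧ (s : Set G) ⊆ C

/-- There is a countable set which is dense for the norm `‖x‖ = inf {2⁻ⁿ : pⁿ divides x}`. -/
def HasCountableDensity (p : ℕ) : Prop :=
  ∃ S : Set G, S.Countable ∧ ∀ (g : G) (n : ℕ), ∃ s ∈ S, ∃ h : G, g - s = p ^ n • h

/-- The subgroup `(pⁿG)[p]`. -/
def ulmSocle (p n : ℕ) : AddSubgroup G :=
  (nsmulAddMonoidHom (α := G) (p ^ n)).range ⊓ (nsmulAddMonoidHom (α := G) p).ker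

/-- The invariant `λ_n(G) = dim ((pⁿG)[p] / (pⁿ⁺¹G)[p])`, over `ℤ/pℤ`. -/
noncomputable def ulmInvariant (p n : ℕ) : Cardinal.{u} :=
  letI : Module (ZMod p) (ulmSocle G p n ⧸ (ulmSocle G p (n + 1)).addSubgroupOf (ulmSocle G p n)) :=
    AddCommGroup.zmodModule (by
      intro x
      induction x using QuotientAddGroup.induction_on with
      | H z =>
        rw [← QuotientAddGroup.mk_nsmul]
        have hz : p • z = 0 := Subtype.ext z.2.2
        rw [hz]
        rfl)
  Module.rank (ZMod p)
    (ulmSocle G p n ⧸ (ulmSocle G p (n + 1)).addSubgroupOf (ulmSocle G p n))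

variable {G}

/-- `g = ∑_{n<ω} f n` for the norm above: the partial sums converge to `g`. -/
def HasPAdicSum (p : ℕ) (f : ℕ → G) (g : G) : Prop :=
  ∀ m : ℕ, ∃ N₀ : ℕ, ∀ N ≥ N₀, ∃ h : G, g - ∑ n ∈ Finset.range N, f n = p ^ m • h

/-- The subgroup generated by all the `x n i`. -/
def familySpan {I : ℕ → Type u} (x : ∀ n, I n → G) : AddSubgroup G :=
  AddSubgroup.closure {g | ∃ n i, g = x n i}

/-- The `x n i` are of order `pⁿ⁺¹` and `⨁_{n,i} ℤ x n i` is a basic subgroup of `G`: the sum is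
direct, it is a pure subgroup, and the quotient of `G` by it is divisible. -/
structure IsBasicFamily (p : ℕ) {I : ℕ → Type u} (x : ∀ n, I n → G) : Prop where
  order : ∀ n i, addOrderOf (x n i) = p ^ (n + 1)
  direct : iSupIndep fun s : (n : ℕ) × I n => AddSubgroup.zmultiples (x s.1 s.2)
  pure : ∀ m : ℕ, ∀ b ∈ familySpan x, (∃ g : G, m • g = b) → ∃ c ∈ familySpan x, m • c = b
  divisible : ∀ m : ℕ, m ≠ 0 → ∀ g : G, ∃ h : G, g - m • h ∈ familySpan x

/-- All elements `∑_{n ≥ k} pⁿ⁻ᵏ x n (η n)` of `G`, for `k < ω` and `η` a branch of the tree given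
by the predecessor functions `F`. -/
def branchSums (p : ℕ) {I : ℕ → Type u} (x : ∀ n, I n → G) (F : ∀ n, I (n + 1) → I n) : Set G :=
  {g | ∃ (k : ℕ) (η : ∀ n, I n), (∀ n, F n (η (n + 1)) = η n) ∧
    HasPAdicSum p (fun n => if k ≤ n then p ^ (n - k) • x n (η n) else 0) g}

variable (G)

/-- Tree-like groups. In the expansion of `g`, `n - k` is truncated, i.e. it is `max (n - k) 0`. -/
def IsTreeLike (p : ℕ) : Prop :=
  ∃ (I : ℕ → Type u) (x : ∀ n, I n → G),
    IsBasicFamily p x ∧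
    (∀ n, #(I n) = ulmInvariant G p n) ∧
    (∀ g : G, ∃ (k : ℕ) (a : ∀ n, I n →₀ ℤ),
      HasPAdicSum p (fun n => (a n).sum fun i c => (c * (p : ℤ) ^ (n - k)) • x n i) g) ∧
    ∃ F : ∀ n, I (n + 1) → I n, ∃ Δ ⊆ branchSums p x F, AddSubgroup.closure Δ = ⊤

/-- `G` is universal among the reduced separable `p`-groups of cardinality `lam`: it is one of
them, and every reduced separable `p`-group of cardinality at most `lam` embeds into it. -/
def IsUniversalReducedSeparable (p : ℕ) (lam : Cardinal.{u}) : Prop :=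
  IsReducedSeparable G p ∧ #G = lam ∧
    ∀ (H : Type u) [AddCommGroup H], IsReducedSeparable H p → #H ≤ lam →
      ∃ f : H →+ G, Function.Injective f

end Groups

/-! ### Trees with `δ + 1` levels -/

section Trees

variable {T : Type u} [PartialOrder T]

/-- The set of elements below `x` is well ordered, of order type `o`. -/
def HasLevel (x : T) (o : Ordinal.{u}) : Prop :=
  ∃ _ : IsWellOrder (Set.Iio x) (· < ·), Ordinal.type (α := Set.Iio x) (· < ·) = o

variable (T)

/-- Trees with `δ + 1` levels, the level `o ≤ δ` having at most `lam o` elements. -/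
structure IsTreeWithLevels (δ : Ordinal.{u}) (lam : Ordinal.{u} → Cardinal.{u}) : Prop where
  level : ∀ x : T, ∃ o ≤ δ, HasLevel x o
  card_level : ∀ o ≤ δ, #{x : T | HasLevel x o} ≤ lam o

/-- A tree in the class into which all the trees of the class embed, by one-to-one maps that
preserve the order, its negation, and the levels. -/
def IsUniversalTree (δ : Ordinal.{u}) (lam : Ordinal.{u} → Cardinal.{u}) : Prop :=
  IsTreeWithLevels T δ lam ∧
    ∀ (S : Type u) [PartialOrder S], IsTreeWithLevels S δ lam →
      ∃ f : S ↪o T, ∀ (x : S) (o : Ordinal.{u}), HasLevel x o → HasLevel (f x) o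

end Trees

/-- The sequence of length `ω + 1` with value `ℵ₀` at all `n < ω` and value `lam` at `ω`. -/
noncomputable def countableThen (lam : Cardinal.{u}) (o : Ordinal.{u}) : Cardinal.{u} :=
  if o < ω then ℵ₀ else lam

/-! The target groups are the groups `treeGroup p Λ`. An element puts a finite charge with values in
ℚ/ℤ on each level, of order dividing `p ^ (n + 1)` on level `n`, and from some level on these
charges are the traces of one finite combination of branches of `Λ`. If distinct branches eventually
separate, finitely many elements are captured by a projection with finite image, so the group is
reduced and separable (`treeGroup_isReducedSeparable`). Single nodes form a basic family, which is
countable if the levels are, and a branch charged with `1 / p ^ (k + 1)` is the sum of `p ^ (n - k)`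
times its nodes. Hence the group is tree-like once every node lies on a branch of `Λ`.

To embed a group `G` (`exists_injective_binary_treeGroup`), start from an embedding `e` of `G` into
a direct sum of copies of ℚ/ℤ indexed by the infinite binary sequences. The traces of `e g` on the
sequences of length `m` determine `g` for large `m`, but these trace homomorphisms may be unbounded,
while level `n` only admits exponent `p ^ (n + 1)`. On a finite subset of `G`, every homomorphism to
ℚ/ℤ agrees with a member of one countable list of bounded homomorphisms
(`exists_approximating_sequence`). Martin's axiom turns this into bounded homomorphisms `φ m` such
that, for each `g`, `φ m g` is the trace of `e g` for all large `m`. Letting the length `s n` grow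
slowly enough for the exponent of `φ (s n)` to fit level `n`, the map sending `g` to the sequence of
all `φ (s n) g` is the embedding.

Level-preserving embeddings of trees induce embeddings of these groups, so the group of the branches
below level `ω` of a universal tree is universal. -/

/-! ### Generic sequences from Martin's axiom -/

/-- A finite initial segment of a sequence of naturals, with finitely many points that the
remaining terms have to respect. -/
structure SequenceCondition {G : Type u} (R : ℕ → ℕ → G → Prop) : Type u where
  len : ℕ
  val : ℕ →₀ ℕ
  promise : Finset G

namespace SequenceCondition

variable {G : Type u} {R : ℕ → ℕ → G → Prop}

/-- A promise binds only the terms added after it was made. Entries of `val` beyond `len` carry no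
information. -/
instance : Preorder (SequenceCondition R) where
  le a b := a.len ≤ b.len ∧ (∀ s < a.len, a.val s = b.val s) ∧ a.promise ⊆ b.promise ∧
    ∀ s, a.len ≤ s → s < b.len → ∀ g ∈ a.promise, R s (b.val s) g
  le_refl a := ⟨le_rfl, fun _ _ => rfl, subset_rfl, fun s h h' => absurd h' h.not_gt⟩
  le_trans a b c hab hbc := by
    refine ⟨hab.1.trans hbc.1, fun s hs => (hab.2.1 s hs).trans (hbc.2.1 s (hs.trans_le hab.1)),
      hab.2.2.1.trans hbc.2.2.1, fun s h h' g hg => ?_⟩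
    rcases lt_or_ge s b.len with hs | hs
    · rw [← hbc.2.1 s hs]
      exact hab.2.2.2 s h hs g hg
    · exact hbc.2.2.2 s hs h' g (hab.2.2.1 hg)

/-- Conditions with the same length and values have a common bound: unite the promises and add no
term. There are only countably many pairs of length and values. -/
theorem isSigmaCentered : IsSigmaCentered (SequenceCondition R) := by
  classical
  obtain ⟨e, he⟩ := exists_surjective_nat (ℕ × (ℕ →₀ ℕ))
  refine ⟨fun n => {a | (a.len, a.val) = e n}, ?_, fun n s hs => ?_⟩
  · ext a
    obtain ⟨n, hn⟩ := he (a.len, a.val)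
    simpa using ⟨n, hn.symm⟩
  · refine ⟨⟨(e n).1, (e n).2, s.biUnion promise⟩, fun a ha => ?_⟩
    have h : (a.len, a.val) = e n := hs ha
    rw [Prod.ext_iff] at h
    refine ⟨h.1.le, fun t _ => DFunLike.congr_fun h.2 t, Finset.subset_biUnion_of_mem promise ha,
      fun t h1 h2 => absurd h2 (not_lt.2 (h.1 ▸ h1))⟩

theorem isCofinal_len (hR : ∀ s (A : Finset G), ∃ k, ∀ g ∈ A, R s k g) (n : ℕ) :
    IsCofinal {a : SequenceCondition R | n ≤ a.len} := by
  induction n with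
  | zero => exact fun a => ⟨a, Nat.zero_le _, le_rfl⟩
  | succ n ih =>
    intro a
    obtain ⟨b, hb, hab⟩ := ih a
    obtain ⟨k, hk⟩ := hR b.len b.promise
    refine ⟨⟨b.len + 1, b.val.update b.len k, b.promise⟩, Nat.succ_le_succ hb, hab.trans ?_⟩
    refine ⟨Nat.le_succ _, fun s hs => ?_, subset_rfl, fun s h h' g hg => ?_⟩
    · simp [Finsupp.update, hs.ne]
    · obtain rfl : s = b.len := by simp at h'; lia
      simpa [Finsupp.update] using hk g hg

theorem isCofinal_promise (g : G) : IsCofinal {a : SequenceCondition R | g ∈ a.promise} := by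
  classical
  intro a
  exact ⟨⟨a.len, a.val, insert g a.promise⟩, Finset.mem_insert_self _ _, le_rfl, fun _ _ => rfl,
    Finset.subset_insert _ _, fun s h h' => absurd h' h.not_gt⟩

end SequenceCondition

/-- If finitely many points can always be served by a single value, then Martin's axiom yields a
sequence of values which serves each of `κ` points from some moment on. -/
theorem MASigmaCentered.exists_eventually {κ : Cardinal.{u}} (hMA : MASigmaCentered κ)
    (hκ : ℵ₀ ≤ κ) {G : Type u} (hG : #G ≤ κ) (R : ℕ → ℕ → G → Prop)
    (hR : ∀ s (A : Finset G), ∃ k, ∀ g ∈ A, R s k g) :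
    ∃ f : ℕ → ℕ, ∀ g, ∃ N, ∀ s ≥ N, R s (f s) g := by
  -- Meeting these sets makes the generic sequence infinite and makes a promise to every point.
  let D : ULift.{u} ℕ ⊕ G → Set (SequenceCondition R) :=
    Sum.elim (fun n => {a | n.down ≤ a.len}) fun g => {a | g ∈ a.promise}
  have : Nonempty (SequenceCondition R) := ⟨⟨0, 0, ∅⟩⟩
  obtain ⟨I, hI⟩ := hMA (SequenceCondition R) SequenceCondition.isSigmaCentered (Set.range D)
    (mk_range_le.trans (by simpa using add_le_of_le hκ hκ hG)) (by
      rintro _ ⟨n | g, rfl⟩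
      · exact SequenceCondition.isCofinal_len hR n.down
      · exact SequenceCondition.isCofinal_promise g)
  choose a ha using fun n : ℕ => hI _ ⟨Sum.inl ⟨n⟩, rfl⟩
  choose b hb using fun g : G => hI _ ⟨Sum.inr g, rfl⟩
  refine ⟨fun s => (a (s + 1)).val s, fun g => ⟨(b g).len, fun s hs => ?_⟩⟩
  -- A common extension `c` agrees with the sequence at `s` and keeps the promise made to `g` in `b
  -- g`.
  obtain ⟨c, -, hac, hbc⟩ := I.directed' _ (ha (s + 1)).1 _ (hb g).1
  have h1 : s < (a (s + 1)).len := (ha (s + 1)).2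
  have h2 : (a (s + 1)).val s = c.val s := hac.2.1 s h1
  simp only [h2]
  exact hbc.2.2.2 s hs (h1.trans_le hac.1) g (hb g).2

/-! ### The group `ℚ / ℤ` -/

/-- The group `ℚ / ℤ`. -/
abbrev RatCircle := AddCircle (1 : ℚ)

namespace RatCircle

/-- The class of `1 / m` in `ℚ / ℤ`. -/
def frac (m : ℕ) : RatCircle := ((1 / m : ℚ) : AddCircle (1 : ℚ))

theorem coe_eq_zero_iff {x : ℚ} : (x : AddCircle (1 : ℚ)) = 0 ↔ ∃ n : ℤ, (n : ℚ) = x := by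
  simp [AddSubgroup.mem_zmultiples_iff]

theorem mul_nsmul_frac (a b : ℕ) (hb : b ≠ 0) : b • frac (a * b) = frac a := by
  have : (b : ℚ) ≠ 0 := by exact_mod_cast hb
  have h : b • (1 / ((a * b : ℕ) : ℚ)) = 1 / a := by
    refine (_root_.nsmul_eq_mul _ _).trans ?_
    push_cast
    rw [one_div, one_div, mul_inv, mul_comm, mul_assoc, inv_mul_cancel₀ this, mul_one]
  rw [frac, frac, ← AddCircle.coe_nsmul, h]

theorem zsmul_frac_eq_zero_iff {m : ℕ} (hm : m ≠ 0) (c : ℤ) : c • frac m = 0 ↔ (m : ℤ) ∣ c := by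
  have hm' : (m : ℚ) ≠ 0 := by exact_mod_cast hm
  rw [frac, ← AddCircle.coe_zsmul, coe_eq_zero_iff]
  constructor
  · rintro ⟨n, hn⟩
    refine ⟨n, ?_⟩
    rw [zsmul_eq_mul] at hn
    field_simp at hn
    rw [mul_comm]
    exact_mod_cast hn.symm
  · rintro ⟨n, rfl⟩
    refine ⟨n, ?_⟩
    rw [zsmul_eq_mul]
    push_cast
    field_simp

theorem nsmul_frac_self (m : ℕ) : m • frac m = 0 := by
  rcases eq_or_ne m 0 with rfl | hm
  · simp
  · rw [← natCast_zsmul, zsmul_frac_eq_zero_iff hm]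

theorem exists_zsmul_frac {m : ℕ} (hm : m ≠ 0) {q : RatCircle} (hq : m • q = 0) :
    ∃ c : ℤ, q = c • frac m := by
  have hm' : (m : ℚ) ≠ 0 := by exact_mod_cast hm
  induction q using QuotientAddGroup.induction_on with
  | H r =>
    have hq' : ((m • r : ℚ) : AddCircle (1 : ℚ)) = 0 := by rw [AddCircle.coe_nsmul]; exact hq
    obtain ⟨n, hn⟩ := coe_eq_zero_iff.1 hq'
    refine ⟨n, ?_⟩
    have h : n • (1 / (m : ℚ)) = r := by
      have hn' : (n : ℚ) = m * r := hn.trans (_root_.nsmul_eq_mul _ _)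
      rw [zsmul_eq_mul, hn']
      field_simp
    rw [frac, ← AddCircle.coe_zsmul, h]

/-- The embedding of `ℤ / m` in `ℚ / ℤ`. -/
def ofZMod (m : ℕ) : ZMod m →+ RatCircle :=
  ZMod.lift m ⟨zmultiplesHom _ (frac m), by simpa using nsmul_frac_self m⟩

theorem ofZMod_intCast (m : ℕ) (c : ℤ) : ofZMod m (c : ZMod m) = c • frac m := by
  simp [ofZMod]

theorem ofZMod_injective {m : ℕ} (hm : m ≠ 0) : Function.Injective (ofZMod m) := by
  rw [injective_iff_map_eq_zero]
  intro a ha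
  obtain ⟨c, rfl⟩ := ZMod.intCast_surjective a
  rw [ofZMod_intCast, zsmul_frac_eq_zero_iff hm] at ha
  exact (ZMod.intCast_zmod_eq_zero_iff_dvd c m).2 ha

theorem nsmul_surjective {m : ℕ} (hm : m ≠ 0) (q : RatCircle) : ∃ r : RatCircle, m • r = q :=
  ⟨DivisibleBy.div q (m : ℤ), by
    rw [← natCast_zsmul]; exact DivisibleBy.div_cancel q (by exact_mod_cast hm)⟩

end RatCircle

/-! ### Extending homomorphisms into divisible groups -/

theorem Finsupp.exists_nsmul_eq {ι : Type*} {m : ℕ} (hm : m ≠ 0) (v : ι →₀ RatCircle) :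
    ∃ w : ι →₀ RatCircle, w.support ⊆ v.support ∧ m • w = v := by
  choose d hd using RatCircle.nsmul_surjective hm
  -- Choosing the root 0 of 0 keeps the support from growing.
  refine ⟨Finsupp.onFinset v.support (fun i => if v i = 0 then 0 else d (v i)) (fun i hi => ?_),
    fun i hi => ?_, ?_⟩
  · by_contra h
    simp at h
    simp [h] at hi
  · by_contra h
    simp at h
    simp [h] at hi
  · ext i
    by_cases h : v i = 0 <;> simp [h, hd]

/-- Divisible abelian groups are injective, by Baer's criterion. -/
theorem exists_extension {A B C : Type*} [AddCommGroup A] [AddCommGroup B] [AddCommGroup C]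
    (hC : ∀ m : ℕ, m ≠ 0 → ∀ c : C, ∃ d : C, m • d = c) (i : A →+ B)
    (hi : Function.Injective i) (f : A →+ C) : ∃ g : B →+ C, ∀ a, g (i a) = f a := by
  let _ : DivisibleBy C ℕ := divisibleByOfSMulRightSurj _ _ fun {m} hm c => hC m hm c
  let _ : DivisibleBy C ℤ := AddGroup.divisibleByIntOfDivisibleByNat C
  obtain ⟨g, hg⟩ := (Module.Baer.of_divisible C).extension_property_addMonoidHom i hi f
  exact ⟨g, fun a => DFunLike.congr_fun hg a⟩

theorem injective_of_injective_on_socle {A B : Type*} [AddCommGroup A] [AddCommGroup B] {p : ℕ}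
    (hA : ∀ x : A, ∃ n : ℕ, p ^ n • x = 0) (f : A →+ B)
    (hf : ∀ x, p • x = 0 → f x = 0 → x = 0) : Function.Injective f := by
  rw [injective_iff_map_eq_zero]
  intro x hx
  obtain ⟨n, hn⟩ := hA x
  induction n with
  | zero => simpa using hn
  | succ n ih =>
    refine ih (hf _ ?_ (by rw [map_nsmul, hx, smul_zero]))
    rw [smul_smul, ← pow_succ', hn]

/-- A `p`-group of size at most the continuum embeds in the direct sum of continuum many copies of
`ℚ / ℤ`. -/
theorem exists_injective_to_finsupp {A : Type u} [AddCommGroup A] {p : ℕ} (hp : p.Prime)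
    (hA : ∀ x : A, ∃ n : ℕ, p ^ n • x = 0) (hcard : #A ≤ 2 ^ (ℵ₀ : Cardinal.{u})) :
    ∃ e : A →+ ((ℕ → Bool) →₀ RatCircle), Function.Injective e := by
  have : Fact p.Prime := ⟨hp⟩
  -- The socle is a vector space over ℤ/p with a basis of size at most the continuum, so it embeds
  -- by its coordinates. The embedding extends because the target is divisible, and the extension is
  -- injective because it is so on the socle.
  let V := (nsmulAddMonoidHom (α := A) p).ker
  let _ : Module (ZMod p) V := AddCommGroup.zmodModule fun x => Subtype.ext x.2
  let b := Module.Basis.ofVectorSpace (ZMod p) V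
  have hι : #(Module.Basis.ofVectorSpaceIndex (ZMod p) V) ≤ 2 ^ (ℵ₀ : Cardinal.{u}) :=
    (mk_subtype_le _).trans ((mk_subtype_le _).trans hcard)
  obtain ⟨r⟩ : Nonempty (Module.Basis.ofVectorSpaceIndex (ZMod p) V ↪ (ℕ → Bool)) := by
    rw [← Cardinal.lift_mk_le']
    simpa using hι
  let j : V →+ ((ℕ → Bool) →₀ RatCircle) :=
    (Finsupp.mapDomain.addMonoidHom r).comp
      ((Finsupp.mapRange.addMonoidHom (RatCircle.ofZMod p)).comp b.repr.toLinearMap.toAddMonoidHom)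
  have hj : Function.Injective j :=
    (Finsupp.mapDomain_injective r.injective).comp
      ((Finsupp.mapRange_injective _ (map_zero _) (RatCircle.ofZMod_injective hp.ne_zero)).comp
        b.repr.injective)
  obtain ⟨e, he⟩ := exists_extension
    (fun m hm c => (Finsupp.exists_nsmul_eq hm c).imp fun _ h => h.2) V.subtype
    V.subtype_injective j
  refine ⟨e, injective_of_injective_on_socle hA e fun x hx h => ?_⟩
  have : e x = j ⟨x, hx⟩ := he ⟨x, hx⟩
  rw [h] at this
  exact congrArg Subtype.val ((injective_iff_map_eq_zero j).1 hj _ this.symm)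

/-! ### Separating points by eventually distinct maps -/

theorem exists_forall_injOn {X : Type*} {Y : ℕ → Type*} (e : ∀ n, X → Y n) (Λ : Set X)
    (h : ∀ a ∈ Λ, ∀ b ∈ Λ, a ≠ b → ∃ N, ∀ n ≥ N, e n a ≠ e n b) (u : Finset X)
    (hu : (u : Set X) ⊆ Λ) : ∃ N, ∀ n ≥ N, Set.InjOn (e n) (u : Set X) := by
  choose! N hN using h
  refine ⟨u.sup fun a => u.sup fun b => N a b, fun n hn a ha b hb hab => ?_⟩
  by_contra hne
  have h1 : N a b ≤ u.sup fun b => N a b := Finset.le_sup (f := fun b => N a b) hb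
  have h2 := Finset.le_sup (f := fun a => u.sup fun b => N a b) ha
  exact hN a (hu ha) b (hu hb) hne n ((h1.trans h2).trans hn) hab

/-- A map injective on `u` pushes forward faithfully whatever is supported in `u`; finitely many
pairs of points are separated from a common moment on. -/
theorem exists_forall_mapDomain_eq_zero {X : Type*} {Y : ℕ → Type*} (e : ∀ n, X → Y n) (Λ : Set X)
    (h : ∀ a ∈ Λ, ∀ b ∈ Λ, a ≠ b → ∃ N, ∀ n ≥ N, e n a ≠ e n b) (u : Finset X)
    (hu : (u : Set X) ⊆ Λ) : ∃ N, ∀ n ≥ N, ∀ v : X →₀ RatCircle, v.support ⊆ u →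
      Finsupp.mapDomain (e n) v = 0 → v = 0 := by
  obtain ⟨N, hN⟩ := exists_forall_injOn e Λ h u hu
  refine ⟨N, fun n hn v hv h0 => ?_⟩
  exact Finsupp.mapDomain_injOn _ (hN n hn) (by exact_mod_cast hv) (by simp)
    (h0.trans Finsupp.mapDomain_zero.symm)

/-- The first `s` values of a sequence. -/
def initialSegment (s : ℕ) (r : ℕ → Bool) : Fin s → Bool := fun j => r j

theorem initialSegment_eventually_ne {a b : ℕ → Bool} (hab : a ≠ b) :
    ∃ N, ∀ n ≥ N, initialSegment n a ≠ initialSegment n b := by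
  obtain ⟨j, hj⟩ := Function.ne_iff.1 hab
  exact ⟨j + 1, fun n hn h => hj (congrFun h ⟨j, hn⟩)⟩

/-! ### Bounded homomorphisms of separable groups -/

section

variable {G : Type u} [AddCommGroup G] {p : ℕ}

/-- A finite summand `C` containing `g` is killed by some `p ^ M`. Writing `g` as a multiple by `p ^
M` therefore puts it in the complement as well. -/
theorem IsReducedSeparable.eq_zero_of_forall_dvd (hG : IsReducedSeparable G p) {g : G}
    (hg : ∀ n : ℕ, ∃ h : G, p ^ n • h = g) : g = 0 := by
  obtain ⟨C, D, hCD, hC, hgC⟩ := hG.separable {g}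
  have hgC : g ∈ C := hgC (by simp)
  choose N hN using hG.torsion
  obtain ⟨M, hM⟩ := (Set.finite_range fun c : C => N c).bddAbove
  obtain ⟨h, hh⟩ := hg M
  obtain ⟨c, hc, d, hd, rfl⟩ := AddSubgroup.mem_sup.1 (hCD.sup_eq_top ▸ AddSubgroup.mem_top h)
  have h1 : p ^ M • c = 0 := by
    rw [← Nat.sub_add_cancel (hM ⟨⟨c, hc⟩, rfl⟩ : N c ≤ M), pow_add, mul_smul, hN, smul_zero]
  rw [smul_add, h1, zero_add] at hh
  have h2 : g ∈ C ⊓ D := ⟨hgC, hh ▸ D.nsmul_mem hd _⟩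
  rwa [hCD.inf_eq_bot] at h2

/-- Embed each quotient of `G` by `p ^ n G` into a sum of copies of ℚ/ℤ indexed by binary sequences,
and take the coordinates of the traces on finite sequences. These are countably many, bounded since
`p ^ n` kills the quotient, and they separate points because no nonzero element is divisible by all
`p ^ n`. -/
theorem exists_separating_sequence (hp : p.Prime) (hG : ∀ x : G, ∃ n : ℕ, p ^ n • x = 0)
    (hcard : #G ≤ 2 ^ (ℵ₀ : Cardinal.{u}))
    (hsep : ∀ g : G, (∀ n : ℕ, ∃ h : G, p ^ n • h = g) → g = 0) :
    ∃ h : ℕ → G →+ RatCircle, (∀ k, ∃ n : ℕ, ∀ g, p ^ n • h k g = 0) ∧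
      ∀ g, (∀ k, h k g = 0) → g = 0 := by
  let R : ℕ → AddSubgroup G := fun n => (nsmulAddMonoidHom (α := G) (p ^ n)).range
  have key : ∀ n, ∃ e : G ⧸ R n →+ ((ℕ → Bool) →₀ RatCircle), Function.Injective e := fun n =>
    exists_injective_to_finsupp hp (by
      intro x
      induction x using QuotientAddGroup.induction_on with
      | H x =>
        obtain ⟨m, hm⟩ := hG x
        exact ⟨m, by rw [← QuotientAddGroup.mk_nsmul, hm]; rfl⟩)
      ((mk_le_of_surjective (QuotientAddGroup.mk'_surjective (R n))).trans hcard)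
  choose e he using key
  let H : ((n : ℕ) × (s : ℕ) × (Fin s → Bool)) → G →+ RatCircle := fun a =>
    (Finsupp.applyAddHom a.2.2).comp ((Finsupp.mapDomain.addMonoidHom (initialSegment a.2.1)).comp
      ((e a.1).comp (QuotientAddGroup.mk' (R a.1))))
  have : Nonempty ((n : ℕ) × (s : ℕ) × (Fin s → Bool)) := ⟨⟨0, 0, fun _ => true⟩⟩
  obtain ⟨c, hc⟩ := exists_surjective_nat ((n : ℕ) × (s : ℕ) × (Fin s → Bool))
  refine ⟨fun k => H (c k), fun k => ⟨(c k).1, fun g => ?_⟩, fun g hg => hsep g fun n => ?_⟩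
  · rw [← map_nsmul]
    have : QuotientAddGroup.mk' (R (c k).1) (p ^ (c k).1 • g) = 0 :=
      (QuotientAddGroup.eq_zero_iff _).2 ⟨g, rfl⟩
    simp only [H, AddMonoidHom.comp_apply, this, map_zero]
  · suffices h : e n (QuotientAddGroup.mk' (R n) g) = 0 by
      have := (injective_iff_map_eq_zero (e n)).1 (he n) _ h
      exact (QuotientAddGroup.eq_zero_iff _).1 this
    obtain ⟨N, hN⟩ := exists_forall_mapDomain_eq_zero initialSegment Set.univ
      (fun a _ b _ => initialSegment_eventually_ne) (e n (QuotientAddGroup.mk' (R n) g)).support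
      (Set.subset_univ _)
    refine hN N le_rfl _ subset_rfl (Finsupp.ext fun i => ?_)
    obtain ⟨k, hk⟩ := hc ⟨n, N, i⟩
    have : H (c k) g = 0 := hg k
    rw [hk] at this
    exact this

/-- Integral combinations of homomorphisms to `ℚ / ℤ` that separate points approximate all
homomorphisms to `ℚ / ℤ` on finite sets. -/
theorem exists_combination_eqOn (hp : p.Prime) (hG : ∀ x : G, ∃ n : ℕ, p ^ n • x = 0)
    (h : ℕ → G →+ RatCircle) (hsep : ∀ g, (∀ k, h k g = 0) → g = 0) (A : Finset G)
    (t : G →+ RatCircle) :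
    ∃ c : ℕ →₀ ℤ, ∀ g ∈ A, (c.sum fun k z => z • h k) g = t g := by
  classical
  let S := AddSubgroup.closure (A : Set G)
  have hfin : Finite S := by
    have : AddGroup.FG S := (AddGroup.fg_iff_addSubgroup_fg S).2 ⟨A, rfl⟩
    refine AddCommGroup.finite_of_fg_isAddTorsion S fun x => ?_
    obtain ⟨n, hn⟩ := hG x
    exact isOfFinAddOrder_iff_nsmul_eq_zero.2 ⟨p ^ n, pow_pos hp.pos n, Subtype.ext (by simpa)⟩
  choose N hN using hG
  obtain ⟨M, hM⟩ := (Set.finite_range fun a : S => N a).bddAbove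
  have hM' : ∀ a ∈ S, p ^ M • a = 0 := fun a ha => by
    rw [← Nat.sub_add_cancel (hM ⟨⟨a, ha⟩, rfl⟩ : N a ≤ M), pow_add, mul_smul, hN, smul_zero]
  have hpM : p ^ M ≠ 0 := pow_ne_zero _ hp.ne_zero
  choose! k hk using fun g (hg : g ≠ 0) => not_forall.1 (mt (hsep g) hg)
  -- As `S` is finite, the first `K + 1` homomorphisms already embed it, and `t` extends along this
  -- embedding.
  obtain ⟨K, hK⟩ := (Set.finite_range fun a : S => k a).bddAbove
  let i : S →+ (Fin (K + 1) → RatCircle) :=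
    (AddMonoidHom.pi fun j : Fin (K + 1) => h j).comp S.subtype
  have hi : Function.Injective i := by
    rw [injective_iff_map_eq_zero]
    intro a ha
    by_contra hne
    have hne' : (a : G) ≠ 0 := fun h0 => hne (Subtype.ext h0)
    exact hk a hne' (congrFun ha ⟨k a, Nat.lt_succ_of_le (hK ⟨a, rfl⟩)⟩)
  obtain ⟨τ, hτ⟩ := exists_extension (fun m hm c => RatCircle.nsmul_surjective hm c) i hi
    (t.comp S.subtype)
  -- All values on `S` are killed by `p ^ M`, and the elements of ℚ/ℤ killed by `p ^ M` form a
  -- cyclic group, so there `τ` acts on each coordinate as an integer.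
  have hc : ∀ j : Fin (K + 1), ∃ c : ℤ,
      τ (Pi.single j (RatCircle.frac (p ^ M))) = c • RatCircle.frac (p ^ M) := fun j => by
    refine RatCircle.exists_zsmul_frac hpM ?_
    rw [← map_nsmul, ← Pi.single_smul, RatCircle.nsmul_frac_self, Pi.single_zero, map_zero]
  choose c hc using hc
  refine ⟨Finsupp.onFinset (Finset.range (K + 1))
    (fun j => if hj : j < K + 1 then c ⟨j, hj⟩ else 0) (fun j hj => ?_), fun g hg => ?_⟩
  · by_contra h'
    simp only [Finset.mem_range] at h'
    simp [h'] at hj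
  · have hgS : g ∈ S := AddSubgroup.subset_closure hg
    have h1 : t g = τ (i ⟨g, hgS⟩) := (hτ ⟨g, hgS⟩).symm
    rw [h1, Finsupp.onFinset_sum _ (by simp), ← Finset.univ_sum_single (i ⟨g, hgS⟩), map_sum,
      Finset.sum_range, AddMonoidHom.finsetSum_apply]
    refine Finset.sum_congr rfl fun j _ => ?_
    obtain ⟨d, hd⟩ := RatCircle.exists_zsmul_frac hpM (q := h j g) (by
      rw [← map_nsmul, hM' g hgS, map_zero])
    have : i ⟨g, hgS⟩ j = h j g := rfl
    rw [this, hd, Pi.single_smul, map_zsmul, hc j]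
    simp only [j.isLt, dif_pos, AddMonoidHom.zsmul_apply, hd]
    exact smul_comm _ _ _

theorem exists_approximating_sequence (hp : p.Prime) (hG : ∀ x : G, ∃ n : ℕ, p ^ n • x = 0)
    (hcard : #G ≤ 2 ^ (ℵ₀ : Cardinal.{u}))
    (hsep : ∀ g : G, (∀ n : ℕ, ∃ h : G, p ^ n • h = g) → g = 0) :
    ∃ h : ℕ → G →+ RatCircle, (∀ k, ∃ n : ℕ, ∀ g, p ^ n • h k g = 0) ∧
      ∀ (A : Finset G) (t : G →+ RatCircle), ∃ k, ∀ g ∈ A, h k g = t g := by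
  obtain ⟨h, hb, hs⟩ := exists_separating_sequence hp hG hcard hsep
  obtain ⟨c, hc⟩ := exists_surjective_nat (ℕ →₀ ℤ)
  refine ⟨fun k => (c k).sum fun k z => z • h k, fun k => ?_, fun A t => ?_⟩
  · choose N hN using hb
    refine ⟨(c k).support.sup N, fun g => ?_⟩
    change p ^ _ • (∑ j ∈ (c k).support, c k j • h j) g = 0
    rw [AddMonoidHom.finsetSum_apply, Finset.smul_sum]
    refine Finset.sum_eq_zero fun j hj => ?_
    rw [AddMonoidHom.zsmul_apply, smul_comm, ← Nat.sub_add_cancel (Finset.le_sup (f := N) hj),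
      pow_add, mul_smul, hN, smul_zero, smul_zero]
  · obtain ⟨d, hd⟩ := exists_combination_eqOn hp hG h hs A t
    obtain ⟨k, hk⟩ := hc d
    exact ⟨k, by simpa only [hk] using hd⟩

end

/-! ### The group of a set of branches -/

section TreeGroup

variable {I : ℕ → Type u}

/-- The combinations of branches from `Λ`, with coefficients of `p`-power order in `ℚ / ℤ`. -/
def branchCharges (p : ℕ) (Λ : Set (∀ n, I n)) : AddSubgroup ((∀ n, I n) →₀ RatCircle) where
  carrier := {v | (∀ η, v η ≠ 0 → η ∈ Λ) ∧ ∃ k : ℕ, p ^ k • v = 0}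
  zero_mem' := ⟨by simp, 0, by simp⟩
  add_mem' := by
    rintro v w ⟨hv, k, hk⟩ ⟨hw, l, hl⟩
    refine ⟨fun η hη => ?_, k + l, ?_⟩
    · by_contra h
      have h1 : v η = 0 := by_contra fun h' => h (hv η h')
      have h2 : w η = 0 := by_contra fun h' => h (hw η h')
      simp [h1, h2] at hη
    · rw [smul_add, pow_add, mul_smul, mul_smul, hl, smul_comm, hk]
      simp
  neg_mem' := by
    rintro v ⟨hv, k, hk⟩
    exact ⟨fun η hη => hv η (by simpa using hη), k, by rw [smul_neg, hk, neg_zero]⟩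

/-- The trace on level `n` of a combination of branches. -/
noncomputable def levelTrace (n : ℕ) : ((∀ n, I n) →₀ RatCircle) →+ (I n →₀ RatCircle) :=
  Finsupp.mapDomain.addMonoidHom fun η => η n

theorem levelTrace_single (n : ℕ) (η : ∀ n, I n) (q : RatCircle) :
    levelTrace n (Finsupp.single η q) = Finsupp.single (η n) q :=
  Finsupp.mapDomain_single

/-- The sequences of finitely supported functions on the levels, with values of order dividing
`p ^ (n + 1)` on level `n`, which are eventually given by a combination of branches from `Λ`. -/
def treeGroup (p : ℕ) (Λ : Set (∀ n, I n)) : AddSubgroup (∀ n, I n →₀ RatCircle) where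
  carrier := {f | (∀ n, p ^ (n + 1) • f n = 0) ∧
    ∃ v ∈ branchCharges p Λ, ∃ N, ∀ n ≥ N, f n = levelTrace n v}
  zero_mem' := ⟨by simp, 0, zero_mem _, 0, by simp⟩
  add_mem' := by
    rintro f g ⟨hf, v, hv, N, hN⟩ ⟨hg, w, hw, M, hM⟩
    refine ⟨fun n => by rw [Pi.add_apply, smul_add, hf, hg, zero_add], v + w, add_mem hv hw,
      max N M, fun n hn => ?_⟩
    rw [Pi.add_apply, hN n (le_of_max_le_left hn), hM n (le_of_max_le_right hn), map_add]
  neg_mem' := by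
    rintro f ⟨hf, v, hv, N, hN⟩
    exact ⟨fun n => by rw [Pi.neg_apply, smul_neg, hf, neg_zero], -v, neg_mem hv, N,
      fun n hn => by rw [Pi.neg_apply, hN n hn, map_neg]⟩

/-- Any two distinct members of `Λ` differ on all but finitely many levels. -/
def EventuallyDistinct (Λ : Set (∀ n, I n)) : Prop :=
  ∀ a ∈ Λ, ∀ b ∈ Λ, a ≠ b → ∃ N, ∀ n ≥ N, a n ≠ b n

variable {p : ℕ} {Λ : Set (∀ n, I n)}

theorem branchCharges_divisible (hp : p.Prime) {v : (∀ n, I n) →₀ RatCircle}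
    (hv : v ∈ branchCharges p Λ) {m : ℕ} (hm : m ≠ 0) : ∃ w ∈ branchCharges p Λ, m • w = v := by
  obtain ⟨hv, k, hk⟩ := hv
  obtain ⟨a, b, hb, rfl⟩ := Nat.exists_eq_pow_mul_and_not_dvd hm p hp.ne_one
  obtain ⟨w, hw, hwv⟩ := Finsupp.exists_nsmul_eq (pow_ne_zero a hp.ne_zero) v
  -- Only the factor `p ^ a` needs genuine division; `b` is invertible modulo `p ^ k`, which kills
  -- `v`, with inverse `c` below.
  have hcop : IsCoprime (b : ℤ) ((p ^ k : ℕ) : ℤ) :=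
    Nat.isCoprime_iff_coprime.2 ((hp.coprime_iff_not_dvd.2 hb).symm.pow_right k)
  obtain ⟨c, d, hcd⟩ := hcop
  refine ⟨c • w, ⟨fun η hη => hv η ?_, a + k, ?_⟩, ?_⟩
  · have : η ∈ w.support := by
      rw [Finsupp.mem_support_iff]
      rintro h
      simp [h] at hη
    simpa using hw this
  · rw [smul_comm, add_comm, pow_add, mul_smul, hwv, hk, smul_zero]
  · rw [mul_comm, mul_smul, smul_comm (p ^ a) c w, hwv, ← natCast_zsmul, smul_smul]
    have : ((b : ℤ) * c) • v + (d * ((p ^ k : ℕ) : ℤ)) • v = v := by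
      rw [← add_smul, mul_comm (b : ℤ) c, hcd, one_smul]
    rwa [mul_smul d, natCast_zsmul, hk, smul_zero, add_zero] at this

theorem mem_treeGroup_of_eventually_zero (f : ∀ n, I n →₀ RatCircle)
    (hf : ∀ n, p ^ (n + 1) • f n = 0) (N : ℕ) (hN : ∀ n ≥ N, f n = 0) : f ∈ treeGroup p Λ :=
  ⟨hf, 0, zero_mem _, N, fun n hn => by rw [hN n hn, map_zero]⟩

theorem tail_mem_treeGroup {v : (∀ n, I n) →₀ RatCircle} (hv : v ∈ branchCharges p Λ) {N : ℕ}
    (hN : p ^ (N + 1) • v = 0) : (fun n => if N ≤ n then levelTrace n v else 0) ∈ treeGroup p Λ := by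
  refine ⟨fun n => ?_, v, hv, N, fun n hn => if_pos hn⟩
  dsimp only
  split_ifs with h
  · rw [← map_nsmul, ← Nat.sub_add_cancel h, add_assoc, pow_add, mul_smul, hN, smul_zero, map_zero]
  · simp

theorem treeGroup_torsion (g : treeGroup p Λ) : ∃ k : ℕ, p ^ k • g = 0 := by
  obtain ⟨f, hf, v, ⟨-, k, hk⟩, N, hN⟩ := g
  refine ⟨k + N, Subtype.ext (funext fun n => ?_)⟩
  change p ^ (k + N) • f n = 0
  rcases le_or_gt N n with h | h
  · rw [hN n h, ← map_nsmul, add_comm, pow_add, mul_smul, hk, smul_zero, map_zero]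
  · rw [← Nat.sub_add_cancel (show n + 1 ≤ k + N by lia), pow_add, mul_smul, hf, smul_zero]

/-- The evaluation at a node. -/
noncomputable def nodeEval (n : ℕ) (i : I n) : treeGroup p Λ →+ RatCircle :=
  (Finsupp.applyAddHom i).comp ((Pi.evalAddMonoidHom _ n).comp (treeGroup p Λ).subtype)

theorem nodeEval_apply (n : ℕ) (i : I n) (g : treeGroup p Λ) : nodeEval n i g = g.1 n i := rfl

theorem treeGroup_ext {g h : treeGroup p Λ} (H : ∀ n i, nodeEval n i g = nodeEval n i h) : g = h :=
  Subtype.ext (funext fun n => Finsupp.ext (H n))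

theorem nsmul_nodeEval (n : ℕ) (i : I n) (g : treeGroup p Λ) : p ^ (n + 1) • nodeEval n i g = 0 :=
  DFunLike.congr_fun (g.2.1 n) i

theorem nodeEval_eq_zero_of_dvd {n m : ℕ} (h : n < m) {g e : treeGroup p Λ} (he : g = p ^ m • e)
    (i : I n) : nodeEval n i g = 0 := by
  rw [he, map_nsmul, ← Nat.sub_add_cancel (show n + 1 ≤ m from h), pow_add, mul_smul,
    nsmul_nodeEval, smul_zero]

theorem isCompl_range_ker {A : Type*} [AddCommGroup A] (P : A →+ A) (hP : ∀ a, P (P a) = P a) :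
    IsCompl P.range P.ker := by
  constructor
  · rw [AddSubgroup.disjoint_def]
    rintro _ ⟨a, rfl⟩ h
    rw [← hP]
    exact h
  · rw [codisjoint_iff, eq_top_iff]
    intro a _
    refine AddSubgroup.mem_sup.2 ⟨P a, ⟨a, rfl⟩, a - P a, ?_, by abel⟩
    rw [AddMonoidHom.mem_ker, map_sub, hP, _root_.sub_self]

/-- The projection onto the finitely many nodes in `J` below level `N`, and the finitely many
branches in `u` above it. -/
theorem exists_projection (N : ℕ) (u : Finset (∀ n, I n)) (hu : (u : Set (∀ n, I n)) ⊆ Λ)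
    (hN : Set.InjOn (fun η : ∀ n, I n => η N) (u : Set (∀ n, I n))) (J : ∀ n, Finset (I n)) :
    ∃ P : treeGroup p Λ →+ treeGroup p Λ,
      (∀ g, ∀ n < N, ∀ i ∈ J n, nodeEval n i (P g) = nodeEval n i g) ∧
      (∀ g, ∀ η ∈ u, nodeEval N (η N) (P g) = nodeEval N (η N) g) ∧
      (∀ g g', (∀ n < N, ∀ i ∈ J n, nodeEval n i g = nodeEval n i g') →
        (∀ η ∈ u, nodeEval N (η N) g = nodeEval N (η N) g') → P g = P g') ∧
      ∀ g, ∀ v : (∀ n, I n) →₀ RatCircle, (∀ n ≥ N, g.1 n = levelTrace n v) → v.support ⊆ u →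
        (∀ n < N, (g.1 n).support ⊆ J n) → P g = g := by
  classical
  -- The charge of a branch of `u` is read off at its node on level `N`, where no two branches of
  -- `u` meet.
  let V : treeGroup p Λ →+ ((∀ n, I n) →₀ RatCircle) :=
    ∑ η ∈ u, (Finsupp.singleAddHom η).comp (nodeEval N (η N))
  have hV : ∀ g η, V g η = if η ∈ u then nodeEval N (η N) g else 0 := fun g η => by
    simp only [V, AddMonoidHom.finsetSum_apply, Finsupp.finsetSum_apply, AddMonoidHom.comp_apply,
      Finsupp.singleAddHom_apply, Finsupp.single_apply]
    rw [Finset.sum_ite_eq']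
  have hVp : ∀ g, p ^ (N + 1) • V g = 0 := fun g => Finsupp.ext fun η => by
    rw [Finsupp.smul_apply, hV]
    split_ifs
    · rw [nsmul_nodeEval]; rfl
    · simp
  have hVu : ∀ g, ((V g).support : Set (∀ n, I n)) ⊆ (u : Set (∀ n, I n)) := fun g η hη => by
    by_contra h
    exact Finsupp.mem_support_iff.1 hη ((hV g η).trans (if_neg h))
  have hVc : ∀ g, V g ∈ branchCharges p Λ := fun g =>
    ⟨fun η hη => hu (hVu g (by simpa using hη)), N + 1, hVp g⟩
  have hfilter : ∀ g : treeGroup p Λ,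
      (fun n => if n < N then (g.1 n).filter (· ∈ J n) else 0) ∈ treeGroup p Λ := fun g => by
    refine mem_treeGroup_of_eventually_zero _ (fun n => ?_) N fun n hn => if_neg (not_lt.2 hn)
    split_ifs
    · ext i
      rw [Finsupp.smul_apply, Finsupp.filter_apply]
      split_ifs
      · exact nsmul_nodeEval n i g
      · simp
    · simp
  let P : treeGroup p Λ →+ treeGroup p Λ := AddMonoidHom.mk'
    (fun g => ⟨_, hfilter g⟩ + ⟨_, tail_mem_treeGroup (hVc g) (hVp g)⟩) (fun g h => by
      refine Subtype.ext (funext fun n => ?_)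
      change (if n < N then Finsupp.filter _ (g.1 n + h.1 n) else 0) +
        (if N ≤ n then levelTrace n (V (g + h)) else 0) =
        ((if n < N then Finsupp.filter _ (g.1 n) else 0) +
        (if N ≤ n then levelTrace n (V g) else 0)) + ((if n < N then Finsupp.filter _ (h.1 n) else 0) +
        (if N ≤ n then levelTrace n (V h) else 0))
      split_ifs
      · lia
      · simp [Finsupp.filter_add]
      · simp
      · simp)
  have hP : ∀ g n, (P g).1 n = (if n < N then (g.1 n).filter (· ∈ J n) else 0) +
      (if N ≤ n then levelTrace n (V g) else 0) := fun _ _ => rfl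
  have hPlt : ∀ g, ∀ n < N, (P g).1 n = (g.1 n).filter (· ∈ J n) := fun g n h => by
    rw [hP, if_pos h, if_neg (not_le.2 h), add_zero]
  have hPge : ∀ g, ∀ n ≥ N, (P g).1 n = levelTrace n (V g) := fun g n h => by
    rw [hP, if_neg (not_lt.2 h), if_pos h, zero_add]
  refine ⟨P, fun g n hn i hi => ?_, fun g η hη => ?_, fun g g' h h' => ?_, fun g v hv hvu hJ => ?_⟩
  · rw [nodeEval_apply, hPlt g n hn, Finsupp.filter_apply, if_pos hi, nodeEval_apply]
  · rw [nodeEval_apply, hPge g N le_rfl]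
    change Finsupp.mapDomain (fun η : ∀ n, I n => η N) (V g) (η N) = _
    rw [Finsupp.mapDomain_apply' _ _ (hVu g) hN hη, hV, if_pos hη]
  · have hVV : V g = V g' := Finsupp.ext fun η => by
      rw [hV, hV]
      split_ifs with hη
      · exact h' η hη
      · rfl
    refine Subtype.ext (funext fun n => ?_)
    rcases lt_or_ge n N with hn | hn
    · rw [hPlt _ n hn, hPlt _ n hn]
      ext i
      rw [Finsupp.filter_apply, Finsupp.filter_apply]
      split_ifs with hi
      · exact h n hn i hi
      · rfl
    · rw [hPge _ n hn, hPge _ n hn, hVV]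
  · have hVv : V g = v := Finsupp.ext fun η => by
      rw [hV]
      split_ifs with hη
      · rw [nodeEval_apply, hv N le_rfl]
        exact Finsupp.mapDomain_apply' _ _ (by exact_mod_cast hvu) hN hη
      · exact (Finsupp.notMem_support_iff.1 fun h => hη (hvu h)).symm
    refine Subtype.ext (funext fun n => ?_)
    rcases lt_or_ge n N with hn | hn
    · rw [hPlt _ n hn, Finsupp.filter_eq_self_iff]
      exact fun i hi => hJ n hn (Finsupp.mem_support_iff.2 hi)
    · rw [hPge _ n hn, hVv, hv n hn]

theorem RatCircle.finite_torsion {m : ℕ} (hm : m ≠ 0) : {q : RatCircle | m • q = 0}.Finite := by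
  have : (Set.range fun c : ZMod m => RatCircle.ofZMod m c).Finite := by
    have : NeZero m := ⟨hm⟩
    exact Set.finite_range _
  refine this.subset fun q hq => ?_
  obtain ⟨c, rfl⟩ := RatCircle.exists_zsmul_frac hm hq
  exact ⟨c, RatCircle.ofZMod_intCast m c⟩

/-- Divisibility by `p ^ (n + 1)` forces the value 0 on level `n`, which gives reducedness.
Separability comes from the idempotent of `exists_projection`, for a level beyond which the elements
of `s` are traces and their branches are distinct. -/
theorem treeGroup_isReducedSeparable (hp : p.Prime) (hΛ : EventuallyDistinct Λ) :
    IsReducedSeparable (treeGroup p Λ) p where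
  torsion := treeGroup_torsion
  reduced D hD := by
    rw [eq_bot_iff]
    intro d hd
    refine treeGroup_ext fun n i => ?_
    obtain ⟨e, -, he⟩ := hD (p ^ (n + 1)) (pow_ne_zero _ hp.ne_zero) d hd
    rw [nodeEval_eq_zero_of_dvd n.lt_succ_self he.symm, map_zero]
  separable s := by
    classical
    choose v hv M hM using fun g : treeGroup p Λ => g.2.2
    let u : Finset (∀ n, I n) := s.biUnion fun g => (v g).support
    have hu : (u : Set (∀ n, I n)) ⊆ Λ := fun η hη => by
      obtain ⟨g, -, hg⟩ := Finset.mem_biUnion.1 hη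
      exact (hv g).1 η (Finsupp.mem_support_iff.1 hg)
    obtain ⟨N₀, hN₀⟩ := exists_forall_injOn (fun n (η : ∀ n, I n) => η n) Λ hΛ u hu
    let N := max N₀ (s.sup M)
    let J : ∀ n, Finset (I n) := fun n => s.biUnion fun g => (g.1 n).support
    obtain ⟨P, h1, h2, h3, h4⟩ :=
      exists_projection (p := p) N u hu (hN₀ N (le_max_left _ _)) J
    have hPP : ∀ g, P (P g) = P g := fun g => h3 _ _ (h1 g) (h2 g)
    refine ⟨P.range, P.ker, isCompl_range_ker P hPP, ?_, fun g hg => ⟨g, h4 g (v g)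
      (fun n hn => hM g n ((Finset.le_sup (f := M) hg).trans ((le_max_right _ _).trans hn)))
      (Finset.subset_biUnion_of_mem (fun g => (v g).support) hg)
      fun n _ => Finset.subset_biUnion_of_mem (fun g : treeGroup p Λ => (g.1 n).support) hg⟩⟩
    -- The values at these nodes determine the image under `P`, and each value ranges over a finite
    -- torsion subgroup.
    let K : Finset ((n : ℕ) × I n) :=
      (Finset.range N).sigma J ∪ u.image fun η => ⟨N, η N⟩
    let E : P.range → K → RatCircle := fun g k => nodeEval k.1.1 k.1.2 g.1
    have hE : Function.Injective E := by
      rintro ⟨_, g, rfl⟩ ⟨_, g', rfl⟩ h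
      refine Subtype.ext ?_
      change P g = P g'
      rw [← hPP g, ← hPP g']
      refine h3 _ _ (fun n hn i hi => ?_) fun η hη => ?_
      · exact congrFun h ⟨⟨n, i⟩, Finset.mem_union_left _
          (Finset.mem_sigma.2 ⟨Finset.mem_range.2 hn, hi⟩)⟩
      · exact congrFun h ⟨⟨N, η N⟩, Finset.mem_union_right _ (Finset.mem_image_of_mem _ hη)⟩
    have hfin : (Set.univ.pi fun k : K => {q : RatCircle | p ^ (k.1.1 + 1) • q = 0}).Finite :=
      Set.Finite.pi fun k => RatCircle.finite_torsion (pow_ne_zero _ hp.ne_zero)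
    have : Finite P.range := by
      refine Set.finite_univ_iff.1 (Set.Finite.of_finite_image (f := E) (hfin.subset ?_) hE.injOn)
      rintro _ ⟨g, -, rfl⟩ k -
      exact nsmul_nodeEval _ _ _
    exact this

end TreeGroup

/-! ### Nodes, branches and cuts: the basic subgroup, generators and cardinality -/

section TreeGroup

variable {I : ℕ → Type u} {p : ℕ} {Λ : Set (∀ n, I n)}

/-- The element of order `p ^ (n + 1)` at a node of level `n`. -/
noncomputable def treeNode (p : ℕ) (Λ : Set (∀ n, I n)) (n : ℕ) (i : I n) : treeGroup p Λ :=
  ⟨Pi.single n (Finsupp.single i (RatCircle.frac (p ^ (n + 1)))),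
    mem_treeGroup_of_eventually_zero _ (fun m => by
      rcases eq_or_ne m n with rfl | h
      · rw [Pi.single_eq_same, Finsupp.smul_single, RatCircle.nsmul_frac_self, Finsupp.single_zero]
      · rw [Pi.single_eq_of_ne h, smul_zero]) (n + 1) fun m hm => Pi.single_eq_of_ne (by lia) _⟩

theorem nodeEval_treeNode_self (n : ℕ) (i : I n) :
    nodeEval n i (treeNode p Λ n i) = RatCircle.frac (p ^ (n + 1)) := by
  simp [nodeEval_apply, treeNode]

theorem nodeEval_treeNode_of_ne_level {n m : ℕ} (h : m ≠ n) (i : I n) (j : I m) :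
    nodeEval m j (treeNode p Λ n i) = 0 := by
  simp [nodeEval_apply, treeNode, Pi.single_eq_of_ne h]

theorem nodeEval_treeNode_of_ne {n : ℕ} {i j : I n} (h : i ≠ j) :
    nodeEval n j (treeNode p Λ n i) = 0 := by
  simp [nodeEval_apply, treeNode, Finsupp.single_eq_of_ne' h]

theorem pow_smul_treeNode (n : ℕ) (i : I n) : p ^ (n + 1) • treeNode p Λ n i = 0 := by
  refine treeGroup_ext fun m j => ?_
  rw [map_nsmul, map_zero]
  rcases eq_or_ne m n with rfl | h
  · exact nsmul_nodeEval m j _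
  · rw [nodeEval_treeNode_of_ne_level h, smul_zero]

theorem zsmul_treeNode_eq_zero (hp : p.Prime) {n : ℕ} {i : I n} {c : ℤ}
    (h : c • nodeEval n i (treeNode p Λ n i) = 0) : c • treeNode p Λ n i = 0 := by
  rw [nodeEval_treeNode_self, RatCircle.zsmul_frac_eq_zero_iff (pow_ne_zero _ hp.ne_zero)] at h
  obtain ⟨d, rfl⟩ := h
  rw [mul_comm, mul_smul, natCast_zsmul, pow_smul_treeNode, smul_zero]

theorem addOrderOf_treeNode (hp : p.Prime) (n : ℕ) (i : I n) :
    addOrderOf (treeNode p Λ n i) = p ^ (n + 1) := by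
  have : Fact p.Prime := ⟨hp⟩
  refine addOrderOf_eq_prime_pow (fun h => ?_) (pow_smul_treeNode n i)
  have h' := congrArg (nodeEval n i) h
  rw [map_nsmul, map_zero, nodeEval_treeNode_self, ← natCast_zsmul,
    RatCircle.zsmul_frac_eq_zero_iff (pow_ne_zero _ hp.ne_zero), Int.natCast_dvd_natCast,
    Nat.pow_dvd_pow_iff_le_right hp.one_lt] at h'
  lia

/-- The part of an element below level `N`. -/
noncomputable def treeCut (N : ℕ) : treeGroup p Λ →+ treeGroup p Λ :=
  AddMonoidHom.mk' (fun g => ⟨fun n => if n < N then g.1 n else 0,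
    mem_treeGroup_of_eventually_zero _ (fun n => by
      split_ifs
      · exact g.2.1 n
      · simp) N fun n hn => if_neg (not_lt.2 hn)⟩) fun g h => Subtype.ext (funext fun n => by
      change (if n < N then g.1 n + h.1 n else 0) =
        (if n < N then g.1 n else 0) + (if n < N then h.1 n else 0)
      split_ifs <;> simp)

theorem nodeEval_treeCut_of_lt {n N : ℕ} (h : n < N) (i : I n) (g : treeGroup p Λ) :
    nodeEval n i (treeCut N g) = nodeEval n i g := by
  change (if n < N then g.1 n else 0) i = _
  rw [if_pos h, nodeEval_apply]

theorem nodeEval_treeCut_of_le {n N : ℕ} (h : N ≤ n) (i : I n) (g : treeGroup p Λ) :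
    nodeEval n i (treeCut N g) = 0 := by
  change (if n < N then g.1 n else 0) i = _
  rw [if_neg (not_lt.2 h), Finsupp.zero_apply]

/-- A late tail of `g` is the trace of a charge `v`, and charges are divisible. This gives
convergence of all expansions, density of the span of the nodes, and divisibility modulo it. -/
theorem exists_sub_treeCut_eq (hp : p.Prime) (g : treeGroup p Λ) {m : ℕ} (hm : m ≠ 0) :
    ∃ N₀, ∀ N ≥ N₀, ∃ h : treeGroup p Λ, g - treeCut N g = m • h := by
  obtain ⟨v, hv, M, hM⟩ := g.2.2
  obtain ⟨w, hw, rfl⟩ := branchCharges_divisible hp hv hm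
  obtain ⟨k, hk⟩ := hw.2
  -- From level `k` on, the values of the trace of `w` have an admissible order.
  refine ⟨max M k, fun N hN => ⟨⟨_, tail_mem_treeGroup hw (N := N) ?_⟩, ?_⟩⟩
  · rw [← Nat.sub_add_cancel (show k ≤ N + 1 by lia), pow_add, mul_smul, hk, smul_zero]
  · refine treeGroup_ext fun n i => ?_
    rw [map_sub, map_nsmul]
    rcases lt_or_ge n N with h | h
    · rw [nodeEval_treeCut_of_lt h, _root_.sub_self, nodeEval_apply]
      simp [not_le.2 h]
    · rw [nodeEval_treeCut_of_le h, _root_.sub_zero, nodeEval_apply, nodeEval_apply, hM n (by lia)]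
      simp [h]

/-- The divisibility of the coefficients of an element annihilated by `p ^ (k + 1)`. -/
theorem exists_coefficients (hp : p.Prime) (g : treeGroup p Λ) :
    ∃ (k : ℕ) (a : ∀ n, I n →₀ ℤ), ∀ n i,
      nodeEval n i g = (a n i * (p : ℤ) ^ (n - k)) • RatCircle.frac (p ^ (n + 1)) := by
  obtain ⟨k, hk⟩ := treeGroup_torsion g
  have key : ∀ n i, ∃ c : ℤ,
      nodeEval n i g = (c * (p : ℤ) ^ (n - k)) • RatCircle.frac (p ^ (n + 1)) := fun n i => by
    -- The exponent is the minimum of `n + 1`, allowed by the level, and `k + 1`, allowed since `p ^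
    -- k` kills `g`.
    have hq : p ^ (n + 1 - (n - k)) • nodeEval n i g = 0 := by
      rcases le_or_gt n k with h | h
      · rw [show n + 1 - (n - k) = n + 1 by lia, nsmul_nodeEval]
      · rw [show n + 1 - (n - k) = 1 + k by lia, pow_add, mul_smul, ← map_nsmul, hk, map_zero,
          smul_zero]
    obtain ⟨c, hc⟩ := RatCircle.exists_zsmul_frac (pow_ne_zero _ hp.ne_zero) hq
    refine ⟨c, ?_⟩
    have h : p ^ (n - k) • RatCircle.frac (p ^ (n + 1)) =
        RatCircle.frac (p ^ (n + 1 - (n - k))) := by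
      rw [← RatCircle.mul_nsmul_frac (p ^ (n + 1 - (n - k))) (p ^ (n - k))
        (pow_ne_zero _ hp.ne_zero), ← pow_add, Nat.sub_add_cancel (show n - k ≤ n + 1 by lia)]
    rw [hc, ← h, mul_smul, ← natCast_zsmul]
    push_cast
    rfl
  choose c hc using key
  refine ⟨k, fun n => Finsupp.onFinset (g.1 n).support
    (fun i => if nodeEval n i g = 0 then 0 else c n i) fun i hi => ?_, fun n i => ?_⟩
  · rw [Finsupp.mem_support_iff]
    intro h
    rw [if_pos (show nodeEval n i g = 0 from h)] at hi
    exact hi rfl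
  · rw [Finsupp.onFinset_apply]
    split_ifs with h
    · rw [h, zero_mul, zero_smul]
    · exact hc n i

theorem nodeEval_levelSum (b : ∀ n, I n →₀ ℤ) (d : ℕ → ℤ) (N m : ℕ) (j : I m) :
    nodeEval m j (∑ n ∈ Finset.range N, (b n).sum fun i c => (c * d n) • treeNode p Λ n i) =
      if m < N then (b m j * d m) • RatCircle.frac (p ^ (m + 1)) else 0 := by
  have h1 : ∀ n, n ≠ m → nodeEval m j ((b n).sum fun i c => (c * d n) • treeNode p Λ n i) = 0 :=
    fun n hn => by
      rw [map_finsuppSum]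
      refine Finset.sum_eq_zero fun i _ => ?_
      dsimp only
      rw [map_zsmul, nodeEval_treeNode_of_ne_level hn.symm, smul_zero]
  have h2 : nodeEval m j ((b m).sum fun i c => (c * d m) • treeNode p Λ m i) =
      (b m j * d m) • RatCircle.frac (p ^ (m + 1)) := by
    rw [map_finsuppSum, Finsupp.sum_eq_single j]
    · rw [map_zsmul, nodeEval_treeNode_self]
    · intro i _ hi
      rw [map_zsmul, nodeEval_treeNode_of_ne hi, smul_zero]
    · simp
  rw [map_sum]
  split_ifs with h
  · rw [Finset.sum_eq_single m (fun n _ hn => h1 n hn)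
      (fun h' => absurd (Finset.mem_range.2 h) h'), h2]
  · exact Finset.sum_eq_zero fun n hn => h1 n fun e => h (e ▸ Finset.mem_range.1 hn)

theorem treeCut_eq_sum (g : treeGroup p Λ) (k : ℕ) (a : ∀ n, I n →₀ ℤ)
    (ha : ∀ n i, nodeEval n i g = (a n i * (p : ℤ) ^ (n - k)) • RatCircle.frac (p ^ (n + 1)))
    (N : ℕ) : treeCut N g =
      ∑ n ∈ Finset.range N, (a n).sum fun i c => (c * (p : ℤ) ^ (n - k)) • treeNode p Λ n i := by
  refine treeGroup_ext fun m j => ?_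
  rw [nodeEval_levelSum a fun n => (p : ℤ) ^ (n - k)]
  split_ifs with h
  · rw [nodeEval_treeCut_of_lt h, ha]
  · rw [nodeEval_treeCut_of_le (not_lt.1 h)]

theorem treeNode_mem_familySpan (n : ℕ) (i : I n) :
    treeNode p Λ n i ∈ familySpan (treeNode p Λ) :=
  AddSubgroup.subset_closure ⟨n, i, rfl⟩

theorem treeCut_mem_familySpan (hp : p.Prime) (N : ℕ) (g : treeGroup p Λ) :
    treeCut N g ∈ familySpan (treeNode p Λ) := by
  obtain ⟨k, a, ha⟩ := exists_coefficients hp g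
  rw [treeCut_eq_sum g k a ha]
  exact sum_mem fun n _ => sum_mem fun i _ => zsmul_mem (treeNode_mem_familySpan n i) _

theorem treeCut_eq_self {N : ℕ} {g : treeGroup p Λ} (h : ∀ n ≥ N, g.1 n = 0) : treeCut N g = g :=
  treeGroup_ext fun n i => by
    rcases lt_or_ge n N with hn | hn
    · rw [nodeEval_treeCut_of_lt hn]
    · rw [nodeEval_treeCut_of_le hn, nodeEval_apply, h n hn, Finsupp.zero_apply]

theorem exists_treeCut_eq_self {g : treeGroup p Λ} (hg : g ∈ familySpan (treeNode p Λ)) :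
    ∃ N, treeCut N g = g := by
  suffices h : ∃ N, ∀ n ≥ N, g.1 n = 0 from h.imp fun N hN => treeCut_eq_self hN
  induction hg using AddSubgroup.closure_induction with
  | mem x hx =>
    obtain ⟨n, i, rfl⟩ := hx
    exact ⟨n + 1, fun m hm => Pi.single_eq_of_ne (by lia) _⟩
  | zero => exact ⟨0, fun _ _ => rfl⟩
  | add x y _ _ hx hy =>
    obtain ⟨N, hN⟩ := hx
    obtain ⟨M, hM⟩ := hy
    exact ⟨max N M, fun n hn => by
      rw [AddSubgroup.coe_add, Pi.add_apply, hN n (le_of_max_le_left hn),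
        hM n (le_of_max_le_right hn), add_zero]⟩
  | neg x _ hx =>
    obtain ⟨N, hN⟩ := hx
    exact ⟨N, fun n hn => by rw [AddSubgroup.coe_neg, Pi.neg_apply, hN n hn, neg_zero]⟩

/-- Evaluation at a node kills all other nodes and is faithful on the multiples of that one, so the
sum is direct. For purity, cut a root of `b` at a level beyond which `b` vanishes. Divisibility of
the quotient is divisibility of tails. -/
theorem treeNode_isBasicFamily (hp : p.Prime) : IsBasicFamily p (treeNode p Λ) where
  order := addOrderOf_treeNode hp
  direct := by
    rintro ⟨n, i⟩
    rw [AddSubgroup.disjoint_def]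
    rintro x hx h
    obtain ⟨c, rfl⟩ := AddSubgroup.mem_zmultiples_iff.1 hx
    have hle : ⨆ (t : (n : ℕ) × I n) (_ : t ≠ ⟨n, i⟩),
        AddSubgroup.zmultiples (treeNode p Λ t.1 t.2) ≤ (nodeEval n i).ker := by
      refine iSup₂_le fun t ht => ?_
      rw [AddSubgroup.zmultiples_le, AddMonoidHom.mem_ker]
      obtain ⟨m, j⟩ := t
      rcases eq_or_ne n m with rfl | hnm
      · exact nodeEval_treeNode_of_ne fun e => ht (congrArg (Sigma.mk n) e)
      · exact nodeEval_treeNode_of_ne_level hnm _ _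
    have := hle h
    rw [AddMonoidHom.mem_ker, map_zsmul] at this
    exact zsmul_treeNode_eq_zero hp this
  pure := by
    rintro m b hb ⟨g, rfl⟩
    obtain ⟨N, hN⟩ := exists_treeCut_eq_self hb
    exact ⟨treeCut N g, treeCut_mem_familySpan hp N g, by rw [← map_nsmul, hN]⟩
  divisible := by
    intro m hm g
    obtain ⟨N, hN⟩ := exists_sub_treeCut_eq hp g hm
    obtain ⟨h, hh⟩ := hN N le_rfl
    exact ⟨h, by rw [← hh, sub_sub_cancel]; exact treeCut_mem_familySpan hp N g⟩

theorem mk_closure_le {A : Type u} [AddCommGroup A] (S : Set A) {κ : Cardinal.{u}} (hκ : ℵ₀ ≤ κ)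
    (hS : #S ≤ κ) : #(AddSubgroup.closure S) ≤ κ := by
  have hfin : #(S →₀ ℤ) ≤ κ := by
    rcases finite_or_infinite S with h | h
    · exact (mk_le_aleph0_iff.2 inferInstance).trans hκ
    · rw [mk_finsupp_lift_of_infinite]
      simp [hS]
  refine (mk_le_of_injective
    (f := fun x : AddSubgroup.closure S => (AddSubgroup.exists_finsupp_of_mem_closure_range
      (Subtype.val : S → A) x.1 (by rw [Subtype.range_coe]; exact x.2)).choose) ?_).trans hfin
  intro x y hxy
  have hx := (AddSubgroup.exists_finsupp_of_mem_closure_range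
      (Subtype.val : S → A) x.1 (by rw [Subtype.range_coe]; exact x.2)).choose_spec
  have hy := (AddSubgroup.exists_finsupp_of_mem_closure_range
      (Subtype.val : S → A) y.1 (by rw [Subtype.range_coe]; exact y.2)).choose_spec
  dsimp only at hxy
  rw [← hxy] at hy
  exact Subtype.ext (hx.trans hy.symm)

theorem setOf_family_eq_range {A : Type*} (x : ∀ n, I n → A) :
    {g | ∃ n i, g = x n i} = Set.range fun t : (n : ℕ) × I n => x t.1 t.2 := by
  ext g
  exact ⟨fun ⟨n, i, h⟩ => ⟨⟨n, i⟩, h.symm⟩, fun ⟨⟨n, i⟩, h⟩ => ⟨n, i, h.symm⟩⟩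

theorem treeGroup_hasCountableDensity (hp : p.Prime) [∀ n, Countable (I n)] :
    HasCountableDensity (treeGroup p Λ) p := by
  refine ⟨familySpan (treeNode p Λ), ?_, fun g m => ?_⟩
  · rw [← Set.countable_coe_iff, ← mk_le_aleph0_iff]
    refine mk_closure_le _ le_rfl ?_
    rw [setOf_family_eq_range]
    exact mk_le_aleph0_iff.2 (Set.countable_range _).to_subtype
  · obtain ⟨N, hN⟩ := exists_sub_treeCut_eq hp g (pow_ne_zero m hp.ne_zero)
    exact ⟨treeCut N g, treeCut_mem_familySpan hp N g, hN N le_rfl⟩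

/-- The tail, from level `k` on, of a branch of `Λ`. -/
noncomputable def treeBranch (p : ℕ) (Λ : Set (∀ n, I n)) (η : Λ) (k : ℕ) : treeGroup p Λ :=
  have h : p ^ (k + 1) • Finsupp.single η.1 (RatCircle.frac (p ^ (k + 1))) = 0 := by
    rw [Finsupp.smul_single, RatCircle.nsmul_frac_self, Finsupp.single_zero]
  ⟨_, tail_mem_treeGroup (v := Finsupp.single η.1 (RatCircle.frac (p ^ (k + 1))))
    ⟨fun θ hθ => by
      rcases eq_or_ne θ η.1 with rfl | hne
      · exact η.2
      · exact absurd (Finsupp.single_eq_of_ne hne) hθ, k + 1, h⟩ h⟩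

theorem treeBranch_apply (η : Λ) (k n : ℕ) : (treeBranch p Λ η k).1 n =
    if k ≤ n then Finsupp.single (η.1 n) (RatCircle.frac (p ^ (k + 1))) else 0 := by
  change (if k ≤ n then levelTrace n (Finsupp.single η.1 _) else 0) = _
  rw [levelTrace_single]

theorem treeCut_treeBranch (hp : p.Prime) (η : Λ) (k N : ℕ) :
    treeCut N (treeBranch p Λ η k) = ∑ n ∈ Finset.range N,
      if k ≤ n then p ^ (n - k) • treeNode p Λ n (η.1 n) else 0 := by
  classical
  rw [treeCut_eq_sum (treeBranch p Λ η k) k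
    (fun n => if k ≤ n then Finsupp.single (η.1 n) 1 else 0)]
  · refine Finset.sum_congr rfl fun n _ => ?_
    split_ifs with h
    · rw [Finsupp.sum_single_index (by simp), one_mul, ← natCast_zsmul]
      push_cast
      rfl
    · exact Finsupp.sum_zero_index
  · intro n i
    rw [nodeEval_apply, treeBranch_apply]
    split_ifs with h
    · rw [Finsupp.single_apply, Finsupp.single_apply]
      split_ifs
      · have : p ^ (n - k) • RatCircle.frac (p ^ (n + 1)) = RatCircle.frac (p ^ (k + 1)) := by
          rw [← RatCircle.mul_nsmul_frac (p ^ (k + 1)) (p ^ (n - k)) (pow_ne_zero _ hp.ne_zero),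
            ← pow_add, show k + 1 + (n - k) = n + 1 by lia]
        rw [one_mul, ← this, ← natCast_zsmul]
        push_cast
        rfl
      · simp
    · simp

theorem hasPAdicSum_treeBranch (hp : p.Prime) (η : Λ) (k : ℕ) :
    HasPAdicSum p (fun n => if k ≤ n then p ^ (n - k) • treeNode p Λ n (η.1 n) else 0)
      (treeBranch p Λ η k) := by
  intro m
  obtain ⟨N₀, h⟩ := exists_sub_treeCut_eq hp (treeBranch p Λ η k) (pow_ne_zero m hp.ne_zero)
  refine ⟨N₀, fun N hN => ?_⟩
  rw [← treeCut_treeBranch hp]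
  exact h N hN

theorem treeGroup_exists_expansion (hp : p.Prime) (g : treeGroup p Λ) :
    ∃ (k : ℕ) (a : ∀ n, I n →₀ ℤ), HasPAdicSum p
      (fun n => (a n).sum fun i c => (c * (p : ℤ) ^ (n - k)) • treeNode p Λ n i) g := by
  obtain ⟨k, a, ha⟩ := exists_coefficients hp g
  refine ⟨k, a, fun m => ?_⟩
  obtain ⟨N₀, h⟩ := exists_sub_treeCut_eq hp g (pow_ne_zero m hp.ne_zero)
  refine ⟨N₀, fun N hN => ?_⟩
  rw [← treeCut_eq_sum g k a ha]
  exact h N hN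

/-- Subtracting branch tails with the same charge as `g` leaves only finitely many nonzero levels, a
combination of nodes. -/
theorem treeGroup_eq_sup (hp : p.Prime) (g : treeGroup p Λ) : g ∈ familySpan (treeNode p Λ) ⊔
    AddSubgroup.closure {g | ∃ η k, g = treeBranch p Λ η k} := by
  obtain ⟨v, hv, N, hN⟩ := g.2.2
  obtain ⟨k, hk⟩ := hv.2
  have hc : ∀ η, ∃ c : ℤ, v η = c • RatCircle.frac (p ^ (k + 1)) := fun η =>
    RatCircle.exists_zsmul_frac (pow_ne_zero _ hp.ne_zero) (by
      rw [← Finsupp.smul_apply, pow_succ', mul_smul, hk, smul_zero, Finsupp.zero_apply])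
  choose c hc using hc
  let b : treeGroup p Λ := ∑ η : v.support,
    c η • treeBranch p Λ ⟨η, hv.1 η (Finsupp.mem_support_iff.1 η.2)⟩ k
  have hb : b ∈ AddSubgroup.closure {g | ∃ η k, g = treeBranch p Λ η k} :=
    sum_mem fun η _ => by
      refine zsmul_mem (AddSubgroup.subset_closure ?_) _
      exact ⟨_, _, rfl⟩
  have hbn : ∀ n ≥ k, b.1 n = levelTrace n v := fun n hn => by
    have h1 : v = ∑ η : v.support, c η • Finsupp.single (η : ∀ n, I n)
        (RatCircle.frac (p ^ (k + 1))) := by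
      conv_lhs => rw [← Finsupp.sum_single v]
      rw [Finsupp.sum, ← Finset.sum_coe_sort]
      exact Finset.sum_congr rfl fun η _ => by rw [Finsupp.smul_single, ← hc]
    rw [h1, map_sum, AddSubgroup.val_finsetSum, Finset.sum_apply]
    refine Finset.sum_congr rfl fun η _ => ?_
    rw [map_zsmul, levelTrace_single, AddSubgroup.coe_zsmul, Pi.smul_apply, treeBranch_apply,
      if_pos hn]
  refine AddSubgroup.mem_sup.2 ⟨g - b, ?_, b, hb, sub_add_cancel _ _⟩
  rw [← treeCut_eq_self (N := max N k) (g := g - b)]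
  · exact treeCut_mem_familySpan hp _ _
  · intro n hn
    rw [AddSubgroup.coe_sub, Pi.sub_apply, hN n (by lia), hbn n (by lia), _root_.sub_self]

theorem mk_treeGroup_le (hp : p.Prime) {κ : Cardinal.{u}} (hκ : ℵ₀ ≤ κ) [∀ n, Countable (I n)]
    (hΛ : #Λ ≤ κ) : #(treeGroup p Λ) ≤ κ := by
  let S : Set (treeGroup p Λ) := (Set.range fun t : (n : ℕ) × I n => treeNode p Λ t.1 t.2) ∪
    Set.range fun t : Λ × ULift.{u} ℕ => treeBranch p Λ t.1 t.2.down
  have hS : #S ≤ κ := by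
    refine (mk_union_le _ _).trans (add_le_of_le hκ ?_ ?_)
    · exact (mk_le_aleph0_iff.2 (Set.countable_range _).to_subtype).trans hκ
    · refine mk_range_le.trans ?_
      rw [mk_prod]
      simpa using mul_le_of_le hκ hΛ hκ
  have htop : AddSubgroup.closure S = ⊤ := by
    rw [eq_top_iff]
    intro g _
    refine sup_le (AddSubgroup.closure_mono ?_) (AddSubgroup.closure_mono ?_)
      (treeGroup_eq_sup hp g)
    · rintro _ ⟨n, i, rfl⟩
      exact Or.inl ⟨⟨n, i⟩, rfl⟩
    · rintro _ ⟨η, k, rfl⟩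
      exact Or.inr ⟨⟨η, ⟨k⟩⟩, rfl⟩
  have := mk_closure_le S hκ hS
  rw [htop] at this
  exact (mk_congr AddSubgroup.topEquiv.toEquiv).symm.le.trans this

theorem treeBranch_injective (hp : p.Prime) (k : ℕ) (hΛ : EventuallyDistinct Λ) :
    Function.Injective fun η : Λ => treeBranch p Λ η k := by
  intro η θ h
  by_contra hne
  obtain ⟨N, hN⟩ := hΛ η.1 η.2 θ.1 θ.2 fun h => hne (Subtype.ext h)
  have h1 : (treeBranch p Λ η k).1 (max N k) = (treeBranch p Λ θ k).1 (max N k) := by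
    simp only at h
    rw [h]
  rw [treeBranch_apply, treeBranch_apply, if_pos (le_max_right _ _),
    if_pos (le_max_right _ _)] at h1
  refine hN _ (le_max_left _ _) (Finsupp.single_left_injective (fun h0 => ?_) h1)
  have := (RatCircle.zsmul_frac_eq_zero_iff (pow_ne_zero (k + 1) hp.ne_zero) 1).1 (by
    rw [h0, smul_zero])
  have h2 := Int.natCast_dvd_natCast.1 (this : ((p ^ (k + 1) : ℕ) : ℤ) ∣ ((1 : ℕ) : ℤ))
  exact hp.one_lt.ne' ((Nat.pow_eq_one.1 (Nat.dvd_one.1 h2)).resolve_right (by lia))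

theorem mk_le_mk_treeGroup (hp : p.Prime) (hΛ : EventuallyDistinct Λ) : #Λ ≤ #(treeGroup p Λ) :=
  mk_le_of_injective (treeBranch_injective hp 0 hΛ)

end TreeGroup

/-! ### Ulm invariants, tree-likeness and functoriality -/

section TreeGroup

variable {I : ℕ → Type u} {p : ℕ} {Λ : Set (∀ n, I n)}

theorem mem_ulmSocle {A : Type u} [AddCommGroup A] {n : ℕ} {a : A} :
    a ∈ ulmSocle A p n ↔ (∃ b, p ^ n • b = a) ∧ p • a = 0 := Iff.rfl

/-- The values on level `n` of the elements of the socle of `p ^ n`. -/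
noncomputable def socleLevel (p : ℕ) (Λ : Set (∀ n, I n)) (n : ℕ) :
    ulmSocle (treeGroup p Λ) p n →+ (I n →₀ RatCircle) :=
  (Pi.evalAddMonoidHom _ n).comp ((treeGroup p Λ).subtype.comp (ulmSocle _ p n).subtype)

/-- If `f` is divisible by `p ^ n` and vanishes on level `n`, it vanishes on all levels up to `n`.
Its late tail is divisible by `p ^ (n + 1)`, and the finitely many levels between are divided one by
one. -/
theorem socleLevel_ker (hp : p.Prime) (n : ℕ) : (socleLevel p Λ n).ker =
    (ulmSocle (treeGroup p Λ) p (n + 1)).addSubgroupOf (ulmSocle (treeGroup p Λ) p n) := by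
  ext ⟨f, hf⟩
  rw [AddMonoidHom.mem_ker, AddSubgroup.mem_addSubgroupOf]
  change f.1 n = 0 ↔ f ∈ ulmSocle (treeGroup p Λ) p (n + 1)
  obtain ⟨⟨g, hg⟩, hpf⟩ := mem_ulmSocle.1 hf
  constructor
  · intro h0
    refine mem_ulmSocle.2 ⟨?_, hpf⟩
    have hpn : p ^ (n + 1) ≠ 0 := pow_ne_zero _ hp.ne_zero
    obtain ⟨N, hN⟩ := exists_sub_treeCut_eq hp f hpn
    obtain ⟨e, he⟩ := hN N le_rfl
    choose d hd using fun m => Finsupp.exists_nsmul_eq hpn (f.1 m)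
    -- As `p` kills `f`, the root `d m` is killed by `p ^ (n + 2)`, which is admissible exactly
    -- above level `n`.
    have hpd : ∀ m > n, p ^ (m + 1) • d m = 0 := fun m hm => by
      rw [← Nat.sub_add_cancel (show (n + 1) + 1 ≤ m + 1 by lia), pow_add, mul_smul, pow_succ',
        mul_smul, (hd m).2]
      have : p • f.1 m = 0 := congrFun (congrArg Subtype.val hpf) m
      rw [this, smul_zero]
    let c : treeGroup p Λ := ⟨fun m => if n < m ∧ m < N then d m else 0,
      mem_treeGroup_of_eventually_zero _ (fun m => by
        split_ifs with h
        · exact hpd m h.1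
        · simp) N fun m hm => if_neg (by lia)⟩
    refine ⟨c + e, ?_⟩
    rw [smul_add, ← he, add_sub, sub_eq_iff_eq_add, add_comm]
    congr 1
    refine treeGroup_ext fun m i => ?_
    rw [map_nsmul]
    rcases lt_or_ge m N with hm | hm
    · rw [nodeEval_treeCut_of_lt hm]
      change p ^ (n + 1) • (if n < m ∧ m < N then d m else 0) i = f.1 m i
      split_ifs with h
      · rw [← Finsupp.smul_apply, (hd m).2]
      · rcases (show m < n ∨ m = n by lia) with h' | rfl
        · rw [Finsupp.zero_apply, smul_zero]
          exact (nodeEval_eq_zero_of_dvd h' hg.symm i).symm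
        · rw [h0, Finsupp.zero_apply, smul_zero]
    · rw [nodeEval_treeCut_of_le hm]
      change p ^ (n + 1) • (if n < m ∧ m < N then d m else 0) i = 0
      rw [if_neg (by lia), Finsupp.zero_apply, smul_zero]
  · intro h
    obtain ⟨⟨e, he⟩, -⟩ := mem_ulmSocle.1 h
    exact Finsupp.ext fun i => nodeEval_eq_zero_of_dvd n.lt_succ_self he.symm i

/-- Every finite charge of order `p` on level `n` occurs: its root for `p ^ n` has order dividing `p
^ (n + 1)`, so it fits on that level. -/
theorem socleLevel_range (hp : p.Prime) (n : ℕ) : (socleLevel p Λ n).range =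
    (Finsupp.mapRange.addMonoidHom (ι := I n) (RatCircle.ofZMod p)).range := by
  ext y
  constructor
  · rintro ⟨⟨f, hf⟩, rfl⟩
    obtain ⟨-, hpf⟩ := mem_ulmSocle.1 hf
    have hc : ∀ i, ∃ c : ZMod p, RatCircle.ofZMod p c = f.1 n i := fun i => by
      obtain ⟨c, hc⟩ := RatCircle.exists_zsmul_frac hp.ne_zero (q := f.1 n i)
        (DFunLike.congr_fun (congrFun (congrArg Subtype.val hpf) n) i)
      exact ⟨c, by rw [hc, RatCircle.ofZMod_intCast]⟩
    choose c hc using hc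
    refine ⟨Finsupp.onFinset (f.1 n).support c fun i hi => ?_, Finsupp.ext fun i => hc i⟩
    rw [Finsupp.mem_support_iff, ← hc]
    exact fun h => hi (RatCircle.ofZMod_injective hp.ne_zero (h.trans (map_zero _).symm))
  · rintro ⟨z, rfl⟩
    obtain ⟨y, -, hy⟩ := Finsupp.exists_nsmul_eq (pow_ne_zero n hp.ne_zero)
      (Finsupp.mapRange.addMonoidHom (RatCircle.ofZMod p) z)
    have hpz : p • Finsupp.mapRange.addMonoidHom (RatCircle.ofZMod p) z = 0 := by
      rw [← map_nsmul]
      have : p • z = 0 := Finsupp.ext fun i => by simp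
      rw [this, map_zero]
    let g : treeGroup p Λ := ⟨Pi.single n y, mem_treeGroup_of_eventually_zero _ (fun m => by
      rcases eq_or_ne m n with rfl | h
      · rw [Pi.single_eq_same, pow_succ', mul_smul, hy, hpz]
      · rw [Pi.single_eq_of_ne h, smul_zero]) (n + 1) fun m hm => Pi.single_eq_of_ne (by lia) _⟩
    refine ⟨⟨p ^ n • g, mem_ulmSocle.2 ⟨⟨g, rfl⟩, treeGroup_ext fun m i => ?_⟩⟩, ?_⟩
    · rw [smul_smul, ← pow_succ', map_nsmul, map_zero]
      rcases eq_or_ne m n with rfl | h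
      · exact nsmul_nodeEval m i g
      · change _ • (Pi.single n y : ∀ n, I n →₀ RatCircle) m i = 0
        rw [Pi.single_eq_of_ne h, Finsupp.zero_apply, smul_zero]
    · change p ^ n • (Pi.single n y : ∀ n, I n →₀ RatCircle) n = _
      rw [Pi.single_eq_same, hy]

theorem rank_eq_of_addEquiv [Fact p.Prime] {M ι : Type u} [AddCommGroup M]
    {_ : Module (ZMod p) M} (e : M ≃+ (ι →₀ ZMod p)) : Module.rank (ZMod p) M = #ι := by
  rw [(e.toLinearEquiv fun c x => ZMod.map_smul e c x).rank_eq, rank_finsupp_self, Cardinal.lift_id']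

theorem ulmInvariant_treeGroup (hp : p.Prime) (n : ℕ) :
    ulmInvariant (treeGroup p Λ) p n = #(I n) := by
  have : Fact p.Prime := ⟨hp⟩
  let ζ := Finsupp.mapRange.addMonoidHom (ι := I n) (RatCircle.ofZMod p)
  have hζ : Function.Injective ζ :=
    Finsupp.mapRange_injective _ (map_zero _) (RatCircle.ofZMod_injective hp.ne_zero)
  let e : (ulmSocle (treeGroup p Λ) p n ⧸
      (ulmSocle (treeGroup p Λ) p (n + 1)).addSubgroupOf (ulmSocle (treeGroup p Λ) p n)) ≃+
      (I n →₀ ZMod p) :=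
    (QuotientAddGroup.quotientAddEquivOfEq (socleLevel_ker hp n).symm).trans
      ((QuotientAddGroup.quotientKerEquivRange (socleLevel p Λ n)).trans
        ((AddEquiv.addSubgroupCongr (socleLevel_range hp n)).trans
          (AddMonoidHom.ofInjective hζ).symm))
  exact rank_eq_of_addEquiv e

/-- If every node of a tree lies on a branch in `Λ`, then the group of `Λ` is tree-like. -/
theorem treeGroup_isTreeLike (hp : p.Prime) (F : ∀ n, I (n + 1) → I n)
    (hF : ∀ η ∈ Λ, ∀ n, F n (η (n + 1)) = η n) (hcov : ∀ n i, ∃ η ∈ Λ, η n = i) :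
    IsTreeLike (treeGroup p Λ) p := by
  refine ⟨I, treeNode p Λ, treeNode_isBasicFamily hp, fun n => (ulmInvariant_treeGroup hp n).symm,
    treeGroup_exists_expansion hp, F, {g | ∃ η k, g = treeBranch p Λ η k}, ?_, ?_⟩
  · rintro _ ⟨η, k, rfl⟩
    exact ⟨k, η.1, hF η.1 η.2, hasPAdicSum_treeBranch hp η k⟩
  · rw [eq_top_iff]
    intro g _
    refine sup_le ((AddSubgroup.closure_le _).2 ?_) le_rfl (treeGroup_eq_sup hp g)
    rintro _ ⟨n, i, rfl⟩
    obtain ⟨η, hη, rfl⟩ := hcov n i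
    -- Since `p` times `1 / p ^ (n + 2)` is `1 / p ^ (n + 1)`, two consecutive tails of a branch
    -- differ by a single node.
    have : treeNode p Λ n (η n) =
        treeBranch p Λ ⟨η, hη⟩ n - p • treeBranch p Λ ⟨η, hη⟩ (n + 1) := by
      refine Subtype.ext (funext fun m => ?_)
      have hfrac : p • RatCircle.frac (p ^ (n + 1 + 1)) = RatCircle.frac (p ^ (n + 1)) := by
        rw [pow_succ _ (n + 1), RatCircle.mul_nsmul_frac _ _ hp.ne_zero]
      rw [AddSubgroup.coe_sub, Pi.sub_apply, AddSubgroup.coe_nsmul, Pi.smul_apply, treeBranch_apply,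
        treeBranch_apply]
      change (Pi.single n _ : ∀ n, I n →₀ RatCircle) m = _
      rcases lt_trichotomy m n with h | rfl | h
      · rw [Pi.single_eq_of_ne h.ne, if_neg (by lia), if_neg (by lia)]
        simp
      · rw [Pi.single_eq_same, if_pos le_rfl, if_neg (by lia)]
        simp
      · rw [Pi.single_eq_of_ne h.ne', if_pos h.le, if_pos (Nat.succ_le_of_lt h), Finsupp.smul_single, hfrac,
          _root_.sub_self]
    rw [this]
    refine sub_mem (AddSubgroup.subset_closure ?_) (nsmul_mem (AddSubgroup.subset_closure ?_) _)
    · exact ⟨_, _, rfl⟩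
    · exact ⟨_, _, rfl⟩

/-- Injective maps of the levels that send branches to branches induce an embedding of groups. -/
theorem exists_injective_treeGroup_map {I' : ℕ → Type u} {Λ' : Set (∀ n, I' n)}
    (j : ∀ n, I n → I' n) (hj : ∀ n, Function.Injective (j n))
    (hΛ : ∀ η ∈ Λ, (fun n => j n (η n)) ∈ Λ') :
    ∃ f : treeGroup p Λ →+ treeGroup p Λ', Function.Injective f := by
  classical
  let B : (∀ n, I n) → ∀ n, I' n := fun η n => j n (η n)
  have hmem : ∀ f : treeGroup p Λ, (fun n => Finsupp.mapDomain (j n) (f.1 n)) ∈ treeGroup p Λ' := by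
    rintro ⟨f, hf, v, ⟨hv, k, hk⟩, N, hN⟩
    refine ⟨fun n => ?_, Finsupp.mapDomain B v, ⟨fun η hη => ?_, k, ?_⟩, N, fun n hn => ?_⟩
    · change p ^ (n + 1) • Finsupp.mapDomain.addMonoidHom (j n) (f n) = 0
      rw [← map_nsmul, hf, map_zero]
    · obtain ⟨θ, hθ, rfl⟩ := Finset.mem_image.1
        (Finsupp.mapDomain_support (Finsupp.mem_support_iff.2 hη))
      exact hΛ θ (hv θ (Finsupp.mem_support_iff.1 hθ))
    · change p ^ k • Finsupp.mapDomain.addMonoidHom B v = 0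
      rw [← map_nsmul, hk, map_zero]
    · change Finsupp.mapDomain (j n) (f n) =
        Finsupp.mapDomain (fun η : ∀ n, I' n => η n) (Finsupp.mapDomain B v)
      rw [hN n hn, ← Finsupp.mapDomain_comp]
      exact Finsupp.mapDomain_comp.symm
  refine ⟨AddMonoidHom.mk' (fun f => ⟨_, hmem f⟩) fun f g => Subtype.ext (funext fun n =>
    Finsupp.mapDomain_add), fun f g h => Subtype.ext (funext fun n => ?_)⟩
  exact Finsupp.mapDomain_injective (hj n) (congrFun (congrArg Subtype.val h) n)

end TreeGroup

/-! ### Embedding separable groups into groups of binary trees -/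

/-- Here `b m` will be an exponent bound for the homomorphism to sequences of length `m`. The length
`s n` is the largest one up to `n` such that this and all smaller lengths have bound at most `n`. -/
theorem exists_slow_sequence (b : ℕ → ℕ) : ∃ s : ℕ → ℕ, Monotone s ∧
    (∀ M, ∃ N, ∀ n ≥ N, M ≤ s n) ∧ ∃ N, ∀ n ≥ N, b (s n) ≤ n := by
  classical
  refine ⟨fun n => Nat.findGreatest (fun t => ∀ j ≤ t, b j ≤ n) n, fun m n hmn => ?_, fun M => ?_,
    -- Before `b 0` the predicate may hold nowhere, and `Nat.findGreatest` then returns its default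
    -- 0.
    b 0, fun n hn => ?_⟩
  · exact Nat.findGreatest_mono (fun t ht j hj => (ht j hj).trans hmn) hmn
  · refine ⟨max M ((Finset.range (M + 1)).sup b), fun n hn => Nat.le_findGreatest (by lia) ?_⟩
    intro j hj
    have := Finset.le_sup (f := b) (Finset.mem_range.2 (Nat.lt_succ_of_le hj))
    lia
  · exact Nat.findGreatest_spec (P := fun t => ∀ j ≤ t, b j ≤ n) (Nat.zero_le n) (by
      intro j hj
      rwa [Nat.le_zero.1 hj]) _ le_rfl

/-- The binary sequences of length `s n`, as level `n` of a tree. -/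
abbrev BinaryLevel (s : ℕ → ℕ) (n : ℕ) : Type u := ULift.{u} (Fin (s n) → Bool)

/-- The branch of initial segments of a sequence. -/
def binaryBranch (s : ℕ → ℕ) (r : ℕ → Bool) : ∀ n, BinaryLevel.{u} s n :=
  fun n => ⟨initialSegment (s n) r⟩

theorem binaryBranch_eventually_ne {s : ℕ → ℕ} (hs : ∀ M, ∃ N, ∀ n ≥ N, M ≤ s n)
    {a b : ℕ → Bool} (hab : a ≠ b) :
    ∃ N, ∀ n ≥ N, binaryBranch.{u} s a n ≠ binaryBranch s b n := by
  obtain ⟨M, hM⟩ := initialSegment_eventually_ne hab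
  obtain ⟨N, hN⟩ := hs M
  exact ⟨N, fun n hn h => hM _ (hN n hn) (congrArg ULift.down h)⟩

theorem binaryBranch_injective {s : ℕ → ℕ} (hs : ∀ M, ∃ N, ∀ n ≥ N, M ≤ s n) :
    Function.Injective (binaryBranch.{u} s) := by
  intro a b h
  by_contra hab
  obtain ⟨N, hN⟩ := binaryBranch_eventually_ne.{u} hs hab
  exact hN N le_rfl (congrFun h N)

theorem eventuallyDistinct_binaryBranch {s : ℕ → ℕ} (hs : ∀ M, ∃ N, ∀ n ≥ N, M ≤ s n)
    (R : Set (ℕ → Bool)) : EventuallyDistinct (binaryBranch.{u} s '' R) := by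
  rintro _ ⟨a, -, rfl⟩ _ ⟨b, -, rfl⟩ hab
  exact binaryBranch_eventually_ne hs fun h => hab (h ▸ rfl)

theorem exists_injective_binary_treeGroup {p : ℕ} (hp : p.Prime) {lam : Cardinal.{u}}
    (hinf : ℵ₀ ≤ lam) (hle : lam ≤ 2 ^ (ℵ₀ : Cardinal.{u})) (hMA : MASigmaCentered lam)
    (G : Type u) [AddCommGroup G] (hG : IsReducedSeparable G p) (hcard : #G ≤ lam) :
    ∃ s : ℕ → ℕ, Monotone s ∧ (∀ M, ∃ N, ∀ n ≥ N, M ≤ s n) ∧ ∃ R : Set (ℕ → Bool),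
      Cardinal.lift.{u} #R ≤ lam ∧ (∀ m (i : Fin m → Bool), ∃ r ∈ R, initialSegment m r = i) ∧
      ∃ f : G →+ treeGroup p (binaryBranch.{u} s '' R), Function.Injective f := by
  classical
  obtain ⟨e, he⟩ := exists_injective_to_finsupp hp hG.torsion (hcard.trans hle)
  obtain ⟨h, hb, ha⟩ := exists_approximating_sequence hp hG.torsion (hcard.trans hle)
    fun g hg => hG.eq_zero_of_forall_dvd hg
  let H : ∀ m, ((Fin m → Bool) → ℕ) → G →+ ((Fin m → Bool) →₀ RatCircle) := fun m c =>
    ∑ i, (Finsupp.singleAddHom i).comp (h (c i))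
  have hH : ∀ m c g i, H m c g i = h (c i) g := fun m c g i => by
    simp only [H, AddMonoidHom.finsetSum_apply, Finsupp.finsetSum_apply, AddMonoidHom.comp_apply,
      Finsupp.singleAddHom_apply, Finsupp.single_apply]
    rw [Finset.sum_ite_eq' Finset.univ i, if_pos (Finset.mem_univ i)]
  choose enc henc using fun m => exists_surjective_nat ((Fin m → Bool) → ℕ)
  -- The value `k m` codes one bounded homomorphism for each binary sequence of length `m`. On a
  -- finite set `A` such a choice can reproduce the trace of `e` exactly.
  obtain ⟨k, hk⟩ := hMA.exists_eventually hinf hcard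
    (fun m k g => H m (enc m k) g = Finsupp.mapDomain (initialSegment m) (e g)) (fun m A => by
      choose c hc using fun i : Fin m → Bool => ha A ((Finsupp.applyAddHom i).comp
        ((Finsupp.mapDomain.addMonoidHom (initialSegment m)).comp e))
      obtain ⟨k, hk⟩ := henc m c
      refine ⟨k, fun g hg => Finsupp.ext fun i => ?_⟩
      rw [hk, hH, hc i g hg]
      rfl)
  let φ : ∀ m, G →+ ((Fin m → Bool) →₀ RatCircle) := fun m => H m (enc m (k m))
  have hφ : ∀ m, ∃ n : ℕ, ∀ g, p ^ n • φ m g = 0 := fun m => by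
    choose N hN using hb
    refine ⟨Finset.univ.sup fun i => N (enc m (k m) i), fun g => Finsupp.ext fun i => ?_⟩
    have := Finset.le_sup (f := fun i => N (enc m (k m) i)) (Finset.mem_univ i)
    rw [Finsupp.smul_apply, hH, ← Nat.sub_add_cancel this, pow_add, mul_smul, hN, smul_zero,
      Finsupp.zero_apply]
  choose b hb using hφ
  obtain ⟨s, hmono, hs, N₀, hN₀⟩ := exists_slow_sequence b
  -- The first summand supplies the branches charged by some `e g`; the second extends every finite
  -- sequence by `false`, so that every node is covered.
  let X := ((g : G) × (e g).support) ⊕ ((m : ℕ) × (Fin m → Bool))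
  let ρ : X → ℕ → Bool := Sum.elim (fun x => x.2.1)
    fun x j => if hj : j < x.1 then x.2 ⟨j, hj⟩ else false
  have hX : Cardinal.lift.{u} #(Set.range ρ) ≤ lam := by
    have h1 : #X ≤ lam := by
      rw [mk_sum, mk_sigma]
      refine add_le_of_le hinf ?_ ?_
      · have : Cardinal.sum (fun g : G => #(e g).support) ≤
            Cardinal.sum (fun _ : G => (ℵ₀ : Cardinal.{0})) :=
          Cardinal.sum_le_sum _ _ fun g => mk_le_aleph0_iff.2 inferInstance
        refine (Cardinal.lift_le.2 this).trans ?_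
        simpa using mul_le_of_le hinf hcard hinf
      · have : #((m : ℕ) × (Fin m → Bool)) ≤ ℵ₀ := mk_le_aleph0_iff.2 inferInstance
        exact (Cardinal.lift_le.2 this).trans (by simpa using hinf)
    have := mk_range_le_lift (f := ρ)
    simp at this
    exact this.trans h1
  refine ⟨s, hmono, hs, Set.range ρ, hX, fun m i => ⟨_, ⟨Sum.inr ⟨m, i⟩, rfl⟩, ?_⟩, ?_⟩
  · funext j
    simp [initialSegment, ρ]
  -- The test on `b (s n)` fails on finitely many levels only, so the default 0 there does not
  -- affect the eventual trace.
  have hmem : ∀ g, (fun n => if b (s n) ≤ n then Finsupp.mapDomain ULift.up (φ (s n) g) else 0) ∈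
      treeGroup p (binaryBranch.{u} s '' Set.range ρ) := fun g => by
    obtain ⟨M, hM⟩ := hk g
    obtain ⟨N, hN⟩ := hs M
    refine ⟨fun n => ?_, Finsupp.mapDomain (binaryBranch s) (e g), ⟨fun η hη => ?_, ?_⟩, max N₀ N,
      fun n hn => ?_⟩
    · dsimp only
      split_ifs with hn
      · change p ^ (n + 1) • Finsupp.mapDomain.addMonoidHom ULift.up (φ (s n) g) = 0
        rw [← map_nsmul, ← Nat.sub_add_cancel (show b (s n) ≤ n + 1 by lia), pow_add, mul_smul, hb,
          smul_zero, map_zero]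
      · simp
    · obtain ⟨r, hr, rfl⟩ := Finset.mem_image.1
        (Finsupp.mapDomain_support (Finsupp.mem_support_iff.2 hη))
      exact ⟨r, ⟨Sum.inl ⟨g, r, hr⟩, rfl⟩, rfl⟩
    · obtain ⟨l, hl⟩ := hG.torsion g
      refine ⟨l, ?_⟩
      change p ^ l • Finsupp.mapDomain.addMonoidHom (binaryBranch s) (e g) = 0
      rw [← map_nsmul, ← map_nsmul, hl, map_zero, map_zero]
    · dsimp only
      rw [if_pos (hN₀ n (le_of_max_le_left hn))]
      change _ = Finsupp.mapDomain _ (Finsupp.mapDomain _ _)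
      rw [show φ (s n) g = _ from hM (s n) (hN n (le_of_max_le_right hn)), ← Finsupp.mapDomain_comp,
        ← Finsupp.mapDomain_comp]
      rfl
  let f : G →+ treeGroup p (binaryBranch.{u} s '' Set.range ρ) :=
    AddMonoidHom.mk' (fun g => ⟨_, hmem g⟩) fun g g' => Subtype.ext (funext fun n => by
      change (if b (s n) ≤ n then Finsupp.mapDomain ULift.up (φ (s n) (g + g')) else 0) =
        (if b (s n) ≤ n then Finsupp.mapDomain ULift.up (φ (s n) g) else 0) +
        (if b (s n) ≤ n then Finsupp.mapDomain ULift.up (φ (s n) g') else 0)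
      split_ifs
      · rw [map_add, Finsupp.mapDomain_add]
      · simp)
  refine ⟨f, (injective_iff_map_eq_zero f).2 fun g hg => ?_⟩
  obtain ⟨M, hM⟩ := hk g
  obtain ⟨M', hM'⟩ := exists_forall_mapDomain_eq_zero initialSegment Set.univ
    (fun a _ b _ => initialSegment_eventually_ne) (e g).support (Set.subset_univ _)
  obtain ⟨N, hN⟩ := hs (max M M')
  let n := max N N₀
  have hn := hN n (le_max_left _ _)
  have h0 : (if b (s n) ≤ n then Finsupp.mapDomain ULift.up (φ (s n) g) else 0 :
      BinaryLevel.{u} s n →₀ RatCircle) = 0 := congrFun (congrArg Subtype.val hg) n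
  rw [if_pos (hN₀ n (le_max_right _ _))] at h0
  have h1 := Finsupp.mapDomain_injective ULift.up_injective (h0.trans Finsupp.mapDomain_zero.symm)
  rw [show φ (s n) g = _ from hM (s n) (by lia)] at h1
  exact (injective_iff_map_eq_zero e).1 he g (hM' (s n) (by lia) _ subset_rfl h1)

theorem isTreeLike_binary_treeGroup {p : ℕ} (hp : p.Prime) {s : ℕ → ℕ} (hs : Monotone s)
    {R : Set (ℕ → Bool)} (hR : ∀ m (i : Fin m → Bool), ∃ r ∈ R, initialSegment m r = i) :
    IsTreeLike (treeGroup p (binaryBranch.{u} s '' R)) p := by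
  refine treeGroup_isTreeLike hp
    (fun n i => ⟨fun j => i.down (Fin.castLE (hs n.le_succ) j)⟩) ?_ fun n i => ?_
  · rintro _ ⟨r, -, rfl⟩ n
    rfl
  · obtain ⟨r, hr, hri⟩ := hR _ i.down
    exact ⟨_, ⟨r, hr, rfl⟩, ULift.ext _ _ hri⟩

theorem mk_binaryBranch_image {s : ℕ → ℕ} (hs : ∀ M, ∃ N, ∀ n ≥ N, M ≤ s n)
    (R : Set (ℕ → Bool)) : #(binaryBranch.{u} s '' R : Set _) = Cardinal.lift.{u} #R := by
  have := Cardinal.mk_image_eq_lift (binaryBranch.{u} s) R (binaryBranch_injective hs)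
  simpa using this

/-! ### Levels in trees -/

section Levels

variable {T : Type u} [PartialOrder T]

theorem HasLevel.unique {x : T} {a b : Ordinal.{u}} (ha : HasLevel x a) (hb : HasLevel x b) :
    a = b := by
  obtain ⟨_, rfl⟩ := ha
  obtain ⟨_, rfl⟩ := hb
  rfl

theorem hasLevel_of_orderIso {x : T} {α : Type} [LinearOrder α] [WellFoundedLT α]
    (e : α ≃o Set.Iio x) :
    HasLevel x (Ordinal.lift.{u} (Ordinal.type (α := α) (· < ·))) := by
  have h : IsWellOrder (Set.Iio x) (· < ·) :=
    e.symm.toRelIsoLT.toRelEmbedding.isWellOrder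
  refine ⟨h, ?_⟩
  have := (Ordinal.lift_type_eq.{0, u, 0} (r := ((· < ·) : α → α → Prop))
    (s := ((· < ·) : Set.Iio x → Set.Iio x → Prop))).2 ⟨e.toRelIsoLT⟩
  simpa using this.symm

/-- The identification of the predecessors of `x` with a segment of the predecessors of `y`. -/
def iioSubrelIso {x y : T} (h : x < y) :
    ((· < ·) : Set.Iio x → Set.Iio x → Prop) ≃r
      Subrel ((· < ·) : Set.Iio y → Set.Iio y → Prop) (· < (⟨x, h⟩ : Set.Iio y)) where
  toFun z := ⟨⟨z.1, z.2.trans h⟩, z.2⟩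
  invFun z := ⟨z.1.1, z.2⟩
  left_inv _ := rfl
  right_inv _ := rfl
  map_rel_iff' := Iff.rfl

/-- The predecessors of `x` are an initial segment of those of `y`. -/
theorem hasLevel_typein {x y : T} [IsWellOrder (Set.Iio y) (· < ·)] (h : x < y) :
    HasLevel x (typein (α := Set.Iio y) (· < ·) ⟨x, h⟩) := by
  have hx : IsWellOrder (Set.Iio x) (· < ·) := (iioSubrelIso h).toRelEmbedding.isWellOrder
  refine ⟨hx, ?_⟩
  rw [← type_subrel]
  exact type_eq.2 ⟨iioSubrelIso h⟩

theorem HasLevel.lt {x y : T} {a b : Ordinal.{u}} (ha : HasLevel x a) (hb : HasLevel y b)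
    (h : x < y) : a < b := by
  obtain ⟨_, rfl⟩ := hb
  rw [ha.unique (hasLevel_typein h)]
  exact typein_lt_type _ _

theorem HasLevel.trichotomous {x y z : T} {a : Ordinal.{u}} (hz : HasLevel z a) (hx : x < z)
    (hy : y < z) : x < y ∨ x = y ∨ y < x := by
  obtain ⟨_, -⟩ := hz
  rcases trichotomous_of (α := Set.Iio z) (· < ·) ⟨x, hx⟩ ⟨y, hy⟩ with h | h | h
  · exact Or.inl h
  · exact Or.inr (Or.inl (congrArg Subtype.val h))
  · exact Or.inr (Or.inr h)

theorem HasLevel.eq_of_lt {x y z : T} {a b : Ordinal.{u}} (hz : HasLevel z a) (hx : HasLevel x b)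
    (hy : HasLevel y b) (hxz : x < z) (hyz : y < z) : x = y := by
  rcases hz.trichotomous hxz hyz with h | h | h
  · exact absurd (hx.lt hy h) (lt_irrefl _)
  · exact h
  · exact absurd (hy.lt hx h) (lt_irrefl _)

variable (T)

/-- The nodes of finite level `n`. -/
abbrev LevelNode (n : ℕ) : Type u := {x : T // HasLevel x (n : Ordinal.{u})}

/-- The branches of nodes below the elements of level `ω`. -/
def limitBranches : Set (∀ n, LevelNode T n) := {η | ∃ x : T, HasLevel x ω ∧ ∀ n, (η n).1 < x}

theorem eventuallyDistinct_limitBranches : EventuallyDistinct (limitBranches T) := by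
  rintro a ⟨x, hx, hax⟩ b ⟨y, hy, hby⟩ hab
  obtain ⟨N, hN⟩ := Function.ne_iff.1 hab
  refine ⟨N, fun n hn h => hN ?_⟩
  rcases hn.lt_or_eq with hlt | rfl
  · have step : ∀ (c : ∀ n, LevelNode T n) (z : T), HasLevel z ω → (∀ n, (c n).1 < z) →
        (c N).1 < (c n).1 := fun c z hz hc => by
      have hord : ((N : ℕ) : Ordinal.{u}) < (n : ℕ) := by exact_mod_cast hlt
      rcases hz.trichotomous (hc N) (hc n) with h' | h' | h'
      · exact h'
      · exact absurd ((c N).2.unique (h' ▸ (c n).2)) hord.ne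
      · exact absurd ((c n).2.lt (c N).2 h') hord.not_gt
    -- If the branches met on level `n`, their nodes on level `N` would both be the unique
    -- predecessor of that level.
    exact Subtype.ext ((a n).2.eq_of_lt (a N).2 (b N).2 (step a x hx hax)
      (h ▸ step b y hy hby))
  · exact h

/-- An element of level `ω` has at most one predecessor on each finite level, so it determines the
branch below it. -/
theorem mk_limitBranches_le : #(limitBranches T) ≤ #{x : T | HasLevel x ω} := by
  refine mk_le_of_injective
    (f := fun η : limitBranches T => ⟨η.2.choose, η.2.choose_spec.1⟩) fun η θ h => ?_
  have h' : η.2.choose = θ.2.choose := congrArg Subtype.val h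
  refine Subtype.ext (funext fun n => Subtype.ext ?_)
  refine η.2.choose_spec.1.eq_of_lt (η.1 n).2 (θ.1 n).2 (η.2.choose_spec.2 n) ?_
  rw [h']
  exact θ.2.choose_spec.2 n

end Levels

/-! ### The tree of binary sequences -/

/-- A nondecreasing unbounded sequence of lengths. -/
structure LevelLengths where
  len : ℕ → ℕ
  mono : Monotone len
  unbounded : ∀ M, ∃ N, ∀ n ≥ N, M ≤ len n

/-- The tree which has the binary sequences of length `s.len n` on level `n`, and the members of
`R` on level `ω`. Finite sequences are continued by `false`. -/
@[ext]
structure SequenceTree (s : LevelLengths) (R : Set (ℕ → Bool)) : Type u where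
  height : ℕ∞
  seq : ℕ → Bool
  mem_of_top : height = ⊤ → seq ∈ R
  eq_false : ∀ n : ℕ, height = n → ∀ j ≥ s.len n, seq j = false

namespace SequenceTree

variable {s : LevelLengths} {R : Set (ℕ → Bool)}

instance : PartialOrder (SequenceTree.{u} s R) where
  le x y := x.height ≤ y.height ∧ ∀ n : ℕ, (n : ℕ∞) ≤ x.height → ∀ j < s.len n, x.seq j = y.seq j
  le_refl x := ⟨le_rfl, fun _ _ _ _ => rfl⟩
  le_trans x y z hxy hyz := ⟨hxy.1.trans hyz.1, fun n hn j hj =>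
    (hxy.2 n hn j hj).trans (hyz.2 n (hn.trans hxy.1) j hj)⟩
  le_antisymm x y hxy hyx := by
    have h := le_antisymm hxy.1 hyx.1
    refine SequenceTree.ext h (funext fun j => ?_)
    rcases eq_or_ne x.height ⊤ with ht | ht
    -- At height `⊤` agreement is required on arbitrarily long initial segments, hence everywhere.
    · obtain ⟨N, hN⟩ := s.unbounded (j + 1)
      exact hxy.2 N (ht ▸ le_top) j (hN N le_rfl)
    · obtain ⟨n, hn⟩ := ENat.ne_top_iff_exists.1 ht
      rcases lt_or_ge j (s.len n) with hj | hj
      · exact hxy.2 n hn.le j hj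
      · rw [x.eq_false n hn.symm j hj, y.eq_false n (h ▸ hn.symm) j hj]

/-- The node of a finite sequence. -/
def node (R : Set (ℕ → Bool)) (n : ℕ) (i : Fin (s.len n) → Bool) : SequenceTree.{u} s R where
  height := n
  seq j := if hj : j < s.len n then i ⟨j, hj⟩ else false
  mem_of_top h := absurd h (ENat.natCast_ne_top n)
  eq_false m hm j hj := by
    obtain rfl : n = m := by exact_mod_cast hm
    exact dif_neg (not_lt.2 hj)

theorem node_injective (n : ℕ) : Function.Injective (node.{u} (s := s) R n) := by
  intro a b h
  funext j
  have := congrFun (congrArg SequenceTree.seq h) j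
  simpa [node] using this

/-- The element of level `ω` of an infinite sequence. -/
def limit {r : ℕ → Bool} (hr : r ∈ R) : SequenceTree.{u} s R where
  height := ⊤
  seq := r
  mem_of_top _ := hr
  eq_false n hn := absurd hn.symm (ENat.natCast_ne_top n)

theorem node_lt {x : SequenceTree.{u} s R} {n : ℕ} (hn : (n : ℕ∞) < x.height) :
    node R n (initialSegment (s.len n) x.seq) < x := by
  refine lt_of_le_of_ne ⟨hn.le, fun m hm j hj => ?_⟩ fun h => hn.ne (congrArg height h)
  have hm' : m ≤ n := Nat.cast_le.1 (show (m : ℕ∞) ≤ n from hm)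
  have : j < s.len n := hj.trans_le (s.mono hm')
  simp [node, this, initialSegment]

theorem node_le_node_iff (r : ℕ → Bool) (n m : ℕ) :
    node.{u} (s := s) R n (initialSegment _ r) ≤ node R m (initialSegment _ r) ↔ n ≤ m := by
  refine ⟨fun h => Nat.cast_le.1 (show (n : ℕ∞) ≤ m from h.1),
    fun h => ⟨show (n : ℕ∞) ≤ m from Nat.cast_le.2 h, fun k hk j hj => ?_⟩⟩
  have hk' : k ≤ n := Nat.cast_le.1 (show (k : ℕ∞) ≤ n from hk)
  have h1 : j < s.len n := hj.trans_le (s.mono hk')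
  have h2 : j < s.len m := h1.trans_le (s.mono h)
  simp [node, h1, h2, initialSegment]

theorem exists_eq_node {x y : SequenceTree.{u} s R} (h : y < x) :
    ∃ n : ℕ, (n : ℕ∞) < x.height ∧ node R n (initialSegment (s.len n) x.seq) = y := by
  have hlt : y.height < x.height := by
    refine lt_of_le_of_ne h.le.1 fun he => h.not_ge ⟨he.ge, fun n hn j hj => ?_⟩
    exact (h.le.2 n (he ▸ hn) j hj).symm
  obtain ⟨n, hn⟩ := ENat.ne_top_iff_exists.1 hlt.ne_top
  refine ⟨n, hn ▸ hlt, SequenceTree.ext hn (funext fun j => ?_)⟩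
  rcases lt_or_ge j (s.len n) with hj | hj
  · simpa [node, hj, initialSegment] using (h.le.2 n hn.le j hj).symm
  · rw [y.eq_false n hn.symm j hj]
    exact dif_neg (not_lt.2 hj)

/-- The predecessors of `x` are exactly the nodes of its initial segments, one for each natural
number below its height. Taking `Fin n` or ℕ for `α` treats finite levels and level `ω` alike. -/
theorem hasLevel_of_strictMono {α : Type} [LinearOrder α] [WellFoundedLT α]
    (x : SequenceTree.{u} s R) (g : α → ℕ) (hg : StrictMono g)
    (hr : ∀ n : ℕ, (n : ℕ∞) < x.height ↔ n ∈ Set.range g) :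
    HasLevel x (Ordinal.lift.{u} (Ordinal.type (α := α) (· < ·))) := by
  let f : α ↪o Set.Iio x := OrderEmbedding.ofMapLEIff
    (fun a => ⟨node R (g a) (initialSegment _ x.seq), node_lt ((hr _).2 ⟨a, rfl⟩)⟩)
    fun a b => (node_le_node_iff x.seq (g a) (g b)).trans hg.le_iff_le
  refine hasLevel_of_orderIso (RelIso.ofSurjective f fun y => ?_)
  obtain ⟨n, hn, hy⟩ := exists_eq_node y.2
  obtain ⟨a, rfl⟩ := (hr n).1 hn
  exact ⟨a, Subtype.ext hy⟩

theorem hasLevel_of_height_eq_nat {x : SequenceTree.{u} s R} {n : ℕ} (hn : x.height = n) :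
    HasLevel x (n : Ordinal.{u}) := by
  have := hasLevel_of_strictMono x (fun a : Fin n => (a : ℕ)) (fun _ _ h => h) fun m => by
    rw [hn]
    exact ⟨fun h => ⟨⟨m, by exact_mod_cast h⟩, rfl⟩, fun ⟨a, ha⟩ => by
      rw [← ha]; exact_mod_cast a.2⟩
  simpa using this

theorem hasLevel_of_height_eq_top {x : SequenceTree.{u} s R} (hx : x.height = ⊤) :
    HasLevel x (ω : Ordinal.{u}) := by
  have := hasLevel_of_strictMono x (fun a : ℕ => a) strictMono_id fun m => by
    simp [hx, lt_top_iff_ne_top]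
  simpa using this

theorem height_eq_nat_of_hasLevel {x : SequenceTree.{u} s R} {n : ℕ}
    (h : HasLevel x (n : Ordinal.{u})) : x.height = n := by
  rcases eq_or_ne x.height ⊤ with hx | hx
  · exact absurd (h.unique (hasLevel_of_height_eq_top hx)) (natCast_lt_omega0 n).ne
  · obtain ⟨m, hm⟩ := ENat.ne_top_iff_exists.1 hx
    have := h.unique (hasLevel_of_height_eq_nat hm.symm)
    rw [← hm]
    exact_mod_cast this.symm

theorem height_eq_top_of_hasLevel {x : SequenceTree.{u} s R} (h : HasLevel x (ω : Ordinal.{u})) :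
    x.height = ⊤ := by
  by_contra hx
  obtain ⟨m, hm⟩ := ENat.ne_top_iff_exists.1 hx
  exact (natCast_lt_omega0 m).ne (h.unique (hasLevel_of_height_eq_nat hm.symm)).symm

theorem isTreeWithLevels {lam : Cardinal.{u}} (hR : Cardinal.lift.{u} #R ≤ lam) :
    IsTreeWithLevels (SequenceTree.{u} s R) ω (countableThen lam) where
  level x := by
    rcases eq_or_ne x.height ⊤ with hx | hx
    · exact ⟨ω, le_rfl, hasLevel_of_height_eq_top hx⟩
    · obtain ⟨m, hm⟩ := ENat.ne_top_iff_exists.1 hx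
      exact ⟨m, (natCast_lt_omega0 m).le, hasLevel_of_height_eq_nat hm.symm⟩
  card_level o ho := by
    rcases ho.lt_or_eq with h | rfl
    · obtain ⟨n, rfl⟩ := lt_omega0.1 h
      rw [countableThen, if_pos h, mk_le_aleph0_iff]
      refine Function.Injective.countable (f := fun x : {x : SequenceTree.{u} s R | HasLevel x n} =>
        initialSegment (s.len n) x.1.seq) fun x y hxy => ?_
      have hx := height_eq_nat_of_hasLevel x.2
      have hy := height_eq_nat_of_hasLevel y.2
      refine Subtype.ext (SequenceTree.ext (hx.trans hy.symm) (funext fun j => ?_))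
      rcases lt_or_ge j (s.len n) with hj | hj
      · exact congrFun hxy ⟨j, hj⟩
      · rw [x.1.eq_false n hx j hj, y.1.eq_false n hy j hj]
    · rw [countableThen, if_neg (lt_irrefl _)]
      refine le_trans ?_ hR
      have := Cardinal.mk_le_of_injective
        (f := fun x : {x : SequenceTree.{u} s R | HasLevel x ω} => (ULift.up.{u}
          (⟨x.1.seq, x.1.mem_of_top (height_eq_top_of_hasLevel x.2)⟩ : R))) fun x y hxy =>
        Subtype.ext (SequenceTree.ext ((height_eq_top_of_hasLevel x.2).trans
          (height_eq_top_of_hasLevel y.2).symm)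
          (congrArg Subtype.val (congrArg ULift.down hxy)))
      simpa using this

end SequenceTree

/-- An embedding of trees that preserves levels induces an embedding of groups. -/
theorem exists_injective_to_limitBranches {p : ℕ} {T : Type u} [PartialOrder T] (s : LevelLengths)
    (R : Set (ℕ → Bool)) (f : SequenceTree.{u} s R ↪o T)
    (hf : ∀ (x : SequenceTree.{u} s R) (o : Ordinal.{u}), HasLevel x o → HasLevel (f x) o) :
    ∃ φ : treeGroup p (binaryBranch.{u} s.len '' R) →+ treeGroup p (limitBranches T),
      Function.Injective φ := by
  refine exists_injective_treeGroup_map (fun n i => ⟨f (SequenceTree.node R n i.down),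
    hf _ _ (SequenceTree.hasLevel_of_height_eq_nat rfl)⟩) (fun n a b h => ?_) ?_
  · exact ULift.ext _ _ (SequenceTree.node_injective n (f.injective (congrArg Subtype.val h)))
  · rintro _ ⟨r, hr, rfl⟩
    refine ⟨f (SequenceTree.limit hr), hf _ _ (SequenceTree.hasLevel_of_height_eq_top rfl),
      fun n => f.lt_iff_lt.2 ?_⟩
    exact SequenceTree.node_lt (x := SequenceTree.limit hr) (ENat.natCast_lt_top n)

/-! ### The main theorem -/

theorem theorem4p1 (p : ℕ) (hp : p.Prime) (lam : Cardinal.{u}) (hinf : ℵ₀ ≤ lam)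
    (hlt : lam < 2 ^ (ℵ₀ : Cardinal.{u})) (hMA : MASigmaCentered lam) :
    (∀ (G : Type u) [AddCommGroup G], IsReducedSeparable G p → #G = lam →
      ∃ (G' : Type u) (_ : AddCommGroup G'),
        IsReducedSeparable G' p ∧ #G' = lam ∧ HasCountableDensity G' p ∧ IsTreeLike G' p ∧
        ∃ f : G →+ G', Function.Injective f) ∧
    ((∃ (T : Type u) (_ : PartialOrder T), IsUniversalTree T ω (countableThen lam)) →
      ∃ (U : Type u) (_ : AddCommGroup U), IsUniversalReducedSeparable U p lam) := by
  constructor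
  · intro G _ hG hcard
    obtain ⟨s, hmono, hs, R, hR, hcov, f, hf⟩ :=
      exists_injective_binary_treeGroup hp hinf hlt.le hMA G hG hcard.le
    refine ⟨treeGroup p (binaryBranch.{u} s '' R), inferInstance,
      treeGroup_isReducedSeparable hp (eventuallyDistinct_binaryBranch hs R), le_antisymm ?_ ?_,
      treeGroup_hasCountableDensity hp, isTreeLike_binary_treeGroup hp hmono hcov, f, hf⟩
    · exact mk_treeGroup_le hp hinf ((mk_binaryBranch_image hs R).trans_le hR)
    · exact hcard.symm.le.trans (mk_le_of_injective hf)
  · rintro ⟨T, _, hT, huniv⟩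
    have hcount : ∀ n, Countable (LevelNode T n) := fun n => by
      have := hT.card_level n (natCast_lt_omega0 n).le
      rw [countableThen, if_pos (natCast_lt_omega0 n)] at this
      exact mk_le_aleph0_iff.1 this
    have hΛ : #(limitBranches T) ≤ lam := by
      have := hT.card_level ω le_rfl
      rw [countableThen, if_neg (lt_irrefl _)] at this
      exact (mk_limitBranches_le T).trans this
    have hle : ∀ (H : Type u) [AddCommGroup H], IsReducedSeparable H p → #H ≤ lam →
        ∃ f : H →+ treeGroup p (limitBranches T), Function.Injective f := fun H _ hH hcard => by
      obtain ⟨s, hmono, hs, R, hR, -, f, hf⟩ :=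
        exists_injective_binary_treeGroup hp hinf hlt.le hMA H hH hcard
      obtain ⟨g, hg⟩ := huniv (SequenceTree.{u} ⟨s, hmono, hs⟩ R) (SequenceTree.isTreeWithLevels hR)
      obtain ⟨φ, hφ⟩ := exists_injective_to_limitBranches (p := p) ⟨s, hmono, hs⟩ R g hg
      exact ⟨φ.comp f, hφ.comp hf⟩
    refine ⟨treeGroup p (limitBranches T), inferInstance,
      treeGroup_isReducedSeparable hp (eventuallyDistinct_limitBranches T),
      le_antisymm (mk_treeGroup_le hp hinf hΛ) ?_, hle⟩
    -- For the lower bound on the cardinality, the group of `lam` branches of the full binary tree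
    -- is reduced and separable of size `lam`, so it embeds in the universal group.
    have hs : ∀ M : ℕ, ∃ N, ∀ n ≥ N, M ≤ id n := fun M => ⟨M, fun _ h => h⟩
    obtain ⟨R, hR⟩ : ∃ R : Set (ℕ → Bool), Cardinal.lift.{u} #R = lam := by
      have hlt' : lam ≤ Cardinal.lift.{u} #(ℕ → Bool) := by simpa using hlt.le
      obtain ⟨c, hc⟩ := Cardinal.mem_range_lift_of_le hlt'
      have : c ≤ #(ℕ → Bool) := by rwa [← Cardinal.lift_le.{u}, hc]
      obtain ⟨R, hR⟩ := Cardinal.le_mk_iff_exists_set.1 this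
      exact ⟨R, by rw [hR, hc]⟩
    have hmk := mk_binaryBranch_image.{u} hs R
    have hd := eventuallyDistinct_binaryBranch.{u} hs R
    obtain ⟨f, hf⟩ := hle (treeGroup p (binaryBranch.{u} id '' R))
      (treeGroup_isReducedSeparable hp hd) (mk_treeGroup_le hp hinf (hmk.trans hR).le)
    exact ((hmk.trans hR).symm.le.trans (mk_le_mk_treeGroup hp hd)).trans (mk_le_of_injective hf)
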